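/- Let $n_k\ge 2$ be integers and $c_k\in(0,1)$ real numbers with $(n_k-1)c_k<1$, for $k\ge 1$. The uniform Cantor set is $E=\bigcap_{k\ge0}E_k$, where $E_0=[0,1]$ and $E_k$ is obtained by deleting from every component $I$ of $E_{k-1}$ $n_k-1$ open intervals (gaps of level $k$) of equal length $c_k|I|$ such that the remaining $n_k$ closed intervals (components of level $k$) have equal length. Let $\delta_k=\prod_{i=1}^k\frac{1-(n_i-1)c_i}{n_i}$ (with $\delta_0=1$) and $\varepsilon_k=c_k\delta_{k-1}$ be the lengths of the components and of the gaps of level $k$. Label the component $[0,1]$ of level $0$ by the empty word and, for a component $I_w$ of level $k-1$, let $I_{w1},\dots,I_{wn_k}$ be the components of level $k$ in $I_w$, from left to right. Let $\mathbb P=\{P_k\}_{k\ge1}$, where $P_k=(p_{k,1},\dots,p_{k,n_k})$ has positive entries with sum $1$, and let $\mu_{\mathbb P}$ be the unique Borel probability measure on $E$ with $\mu_{\mathbb P}(I_{wi})=p_{k,i}\,\mu_{\mathbb P}(I_w)$ for all $k\ge1$, all words $w$ of length $k-1$ and all $1\le i\le n_k$. A Borel measure $\mu$ on $E$ is doubling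 if there is $C\ge1$ with $0<\mu(B(x,2r))\le C\mu(B(x,r))<\infty$ for all $x\in E$ and $r>0$. Let $\Lambda=\{k\ge1:\varepsilon_k<\delta_k\}$. For $k\in\Lambda$ let $m_k$ be the unique positive integer with $\delta_{k+m_k}\le\varepsilon_k<\delta_{k+m_k-1}$, and let $s_k$ be the unique positive integer with $$s_k\delta_{k+m_k}+(s_k-1)\varepsilon_{k+m_k}\le\varepsilon_k<(s_k+1)\delta_{k+m_k}+s_k\varepsilon_{k+m_k}.$$ For $C\ge1$ and an integer $s\ge1$, a vector $(q_1,\dots,q_m)$ with positive entries is called $(C,s)$-uniform if $$C^{-1}\le\frac{q_{i+1}+\cdots+q_{i+l}}{q_{j+1}+\cdots+q_{j+l}}\le C$$ for all integers $i,j,l$ with $s\le l\le m$ and $0\le i\le j\le i+l\le j+l\le m$; it is called $C$-uniform if it is $(C,1)$-uniform. The sequence $\mathbb P$ is $C$-uniform if every $P_k$ is $C$-uniform. For a vector $P=(q_1,\dots,q_m)$ put $(P,P)=(q_1,\dots,q_m,q_1,\dots,q_m)$. Suppose that $\sup_{k\in\Lambda}m_k<\infty$. Then $\mu_{\mathbb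 P}$ is doubling on $E$ if and only if there is a constant $C>1$ such that (a) $\mathbb P$ is $C$-uniform, and (b) for every $k\in\Lambda$, $(P_{k+t},P_{k+t})$ is $C$-uniform for all $1\le t<m_k$, and $(P_{k+m_k},P_{k+m_k})$ is $(C,s_k)$-uniform. -/

import Mathlib

namespace UniformCantor

open MeasureTheory Set

noncomputable section

/-! ### The uniform Cantor set

The data are sequences `n : ℕ → ℕ` and `c : ℕ → ℝ`; only the terms of index `k ≥ 1` are used. -/

/-- The admissible data of a uniform Cantor set: for every `k ≥ 1`, `n k ≥ 2`, `0 < c k < 1` and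
`(n k - 1) * c k < 1`. -/
structure IsCantorData (n : ℕ → ℕ) (c : ℕ → ℝ) : Prop where
  two_le : ∀ k, 1 ≤ k → 2 ≤ n k
  c_pos : ∀ k, 1 ≤ k → 0 < c k
  c_lt_one : ∀ k, 1 ≤ k → c k < 1
  mul_lt_one : ∀ k, 1 ≤ k → ((n k : ℝ) - 1) * c k < 1

/-- `δ_k`, the length of a component of level `k`. -/
def compLen (n : ℕ → ℕ) (c : ℕ → ℝ) (k : ℕ) : ℝ :=
  ∏ i ∈ Finset.Icc 1 k, (1 - ((n i : ℝ) - 1) * c i) / (n i : ℝ)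

/-- `ε_k = c_k δ_{k-1}`, the length of a gap of level `k` (used for `k ≥ 1`). -/
def gapLen (n : ℕ → ℕ) (c : ℕ → ℝ) (k : ℕ) : ℝ :=
  c k * compLen n c (k - 1)

/-- Words of length `k`. Letters are counted from `0`: the entry `w j`, `j = 0, …, k - 1`, is the
letter of level `j + 1`, and it runs through `0, …, n (j + 1) - 1`. -/
abbrev Word (n : ℕ → ℕ) (k : ℕ) : Type := (j : Fin k) → Fin (n ((j : ℕ) + 1))

/-- The left endpoint of the component `I_w`: passing from `I_w` to its sub-component number `i`
(counted from `0`, from left to right) moves the left endpoint by `i * (δ_{k+1} + ε_{k+1})`. -/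
def leftEnd (n : ℕ → ℕ) (c : ℕ → ℝ) {k : ℕ} (w : Word n k) : ℝ :=
  ∑ j : Fin k, ((w j : ℕ) : ℝ) * (compLen n c ((j : ℕ) + 1) + gapLen n c ((j : ℕ) + 1))

/-- The component `I_w` of level `k`, a closed interval of length `δ_k`. -/
def component (n : ℕ → ℕ) (c : ℕ → ℝ) {k : ℕ} (w : Word n k) : Set ℝ :=
  Icc (leftEnd n c w) (leftEnd n c w + compLen n c k)

/-- `E_k`, the union of the components of level `k`; `E_0 = [0, 1]`. -/
def levelSet (n : ℕ → ℕ) (c : ℕ → ℝ) (k : ℕ) : Set ℝ :=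
  ⋃ w : Word n k, component n c w

/-- The uniform Cantor set `E(n, c) = ⋂ E_k`. -/
def cantorSet (n : ℕ → ℕ) (c : ℕ → ℝ) : Set ℝ :=
  ⋂ k : ℕ, levelSet n c k

/-! ### The indices `Λ`, `m_k`, `s_k` -/

/-- `Λ = {k ≥ 1 : ε_k < δ_k}`. -/
def Lam (n : ℕ → ℕ) (c : ℕ → ℝ) : Set ℕ :=
  {k | 1 ≤ k ∧ gapLen n c k < compLen n c k}

/-- The set of positive integers `m` with `δ_{k+m} ≤ ε_k < δ_{k+m-1}`. -/
def mSet (n : ℕ → ℕ) (c : ℕ → ℝ) (k : ℕ) : Set ℕ :=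
  {m | 1 ≤ m ∧ compLen n c (k + m) ≤ gapLen n c k ∧ gapLen n c k < compLen n c (k + m - 1)}

/-- `m_k`: for `k ∈ Λ`, the unique element of `mSet n c k` (see `existsUnique_mem_mSet`). -/
def mIdx (n : ℕ → ℕ) (c : ℕ → ℝ) (k : ℕ) : ℕ := sInf (mSet n c k)

/-- The set of positive integers `s` with
`s δ_{k+m_k} + (s-1) ε_{k+m_k} ≤ ε_k < (s+1) δ_{k+m_k} + s ε_{k+m_k}`. -/
def sSet (n : ℕ → ℕ) (c : ℕ → ℝ) (k : ℕ) : Set ℕ :=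
  {s | 1 ≤ s ∧
    (s : ℝ) * compLen n c (k + mIdx n c k) + ((s : ℝ) - 1) * gapLen n c (k + mIdx n c k)
      ≤ gapLen n c k ∧
    gapLen n c k < ((s : ℝ) + 1) * compLen n c (k + mIdx n c k)
      + (s : ℝ) * gapLen n c (k + mIdx n c k)}

/-- `s_k`: for `k ∈ Λ`, the unique element of `sSet n c k` (see `existsUnique_mem_sSet`). -/
def sIdx (n : ℕ → ℕ) (c : ℕ → ℝ) (k : ℕ) : ℕ := sInf (sSet n c k)

/-! ### Probability vectors and uniformness -/

/-- `p` is a positive probability vector. -/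
def IsPosProb {m : ℕ} (p : Fin m → ℝ) : Prop :=
  (∀ i, 0 < p i) ∧ ∑ i, p i = 1

/-- The sum `p_{i+1} + ⋯ + p_{i+l}` of `l` consecutive entries of `p = (p_1, …, p_m)`; the entry
`p_{a+1}` is the value of `p` at the index `a : Fin m`. -/
def blockSum {m : ℕ} (p : Fin m → ℝ) (i l : ℕ) : ℝ :=
  ∑ a ∈ (Finset.univ : Finset (Fin m)).filter (fun a : Fin m => i ≤ (a : ℕ) ∧ (a : ℕ) < i + l), p a

/-- `(C, s)`-uniformness of a vector with `m` entries. -/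
def IsUniformFrom (C : ℝ) (s : ℕ) {m : ℕ} (p : Fin m → ℝ) : Prop :=
  ∀ i j l : ℕ, s ≤ l → l ≤ m → i ≤ j → j ≤ i + l → j + l ≤ m →
    C⁻¹ ≤ blockSum p i l / blockSum p j l ∧ blockSum p i l / blockSum p j l ≤ C

/-- `C`-uniformness is `(C, 1)`-uniformness. -/
def IsUniform (C : ℝ) {m : ℕ} (p : Fin m → ℝ) : Prop := IsUniformFrom C 1 p

/-- The concatenation `(P, P)`. -/
def twice {m : ℕ} (p : Fin m → ℝ) : Fin (m + m) → ℝ := Fin.append p p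

/-! ### The measure `μ_P` and the doubling property -/

/-- The point of the Cantor set coded by an infinite word. -/
def point (n : ℕ → ℕ) (c : ℕ → ℝ) (ω : (j : ℕ) → Fin (n (j + 1))) : ℝ :=
  ∑' j : ℕ, ((ω j : ℕ) : ℝ) * (compLen n c (j + 1) + gapLen n c (j + 1))

/-- The measure on `{0, …, m - 1}` with weights `p`. -/
def vecMeasure {m : ℕ} (p : Fin m → ℝ) : Measure (Fin m) :=
  ∑ i, ENNReal.ofReal (p i) • Measure.dirac i

/-- The measure `μ_P` on `E(n, c)`: the image of the product of the measures given by the vectors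
`P_1, P_2, …` under the coding map. It is a probability measure with
`μ_P(I_{wi}) = p_{k,i} μ_P(I_w)`, see `isProbabilityMeasure_cantorMeasure` and
`cantorMeasure_component`. -/
def cantorMeasure (n : ℕ → ℕ) (c : ℕ → ℝ) (P : (k : ℕ) → Fin (n k) → ℝ) :
    Measure (cantorSet n c) :=
  ((Measure.infinitePi fun j : ℕ => vecMeasure (P (j + 1))).map (point n c)).comap
    (Subtype.val : cantorSet n c → ℝ)

/-- A Borel measure on a metric space is doubling. (A `Measure` on a Borel space, viewed as an
outer measure, is automatically Borel regular.) -/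
def IsDoubling {X : Type*} [MetricSpace X] [MeasurableSpace X] [BorelSpace X]
    (μ : Measure X) : Prop :=
  ∃ C : ℝ, 1 ≤ C ∧ ∀ (x : X) (r : ℝ), 0 < r →
    0 < μ (Metric.ball x (2 * r)) ∧
    μ (Metric.ball x (2 * r)) ≤ ENNReal.ofReal C * μ (Metric.ball x r) ∧
    ENNReal.ofReal C * μ (Metric.ball x r) < ⊤

/-! ### The objects above are well defined -/

section Facts

variable {n : ℕ → ℕ} {c : ℕ → ℝ}

theorem compLen_zero : compLen n c 0 = 1 := by simp [compLen]

theorem compLen_succ (k : ℕ) : compLen n c (k + 1) =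
    compLen n c k * ((1 - ((n (k + 1) : ℝ) - 1) * c (k + 1)) / (n (k + 1) : ℝ)) := by
  unfold compLen
  rw [Finset.prod_Icc_succ_top (by omega)]

theorem gapLen_succ (k : ℕ) : gapLen n c (k + 1) = c (k + 1) * compLen n c k := rfl

theorem IsCantorData.two_le_real (h : IsCantorData n c) (k : ℕ) : (2 : ℝ) ≤ n (k + 1) := by
  exact_mod_cast h.two_le (k + 1) (by omega)

theorem IsCantorData.compLen_pos (h : IsCantorData n c) (k : ℕ) : 0 < compLen n c k := by
  induction k with
  | zero => simp [compLen_zero]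
  | succ k ih =>
    rw [compLen_succ]
    have h1 := h.mul_lt_one (k + 1) (by omega)
    have h2 := h.two_le_real k
    exact mul_pos ih (div_pos (by linarith) (by linarith))

theorem IsCantorData.gapLen_pos (h : IsCantorData n c) (k : ℕ) : 0 < gapLen n c (k + 1) := by
  rw [gapLen_succ]
  exact mul_pos (h.c_pos _ (by omega)) (h.compLen_pos k)

/-- A component of level `k` consists of `n_{k+1}` components and `n_{k+1} - 1` gaps of level
`k + 1`. -/
theorem IsCantorData.split (h : IsCantorData n c) (k : ℕ) :
    (n (k + 1) : ℝ) * compLen n c (k + 1) + ((n (k + 1) : ℝ) - 1) * gapLen n c (k + 1)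
      = compLen n c k := by
  have h2 := h.two_le_real k
  have h3 : (n (k + 1) : ℝ) ≠ 0 := by linarith
  rw [compLen_succ, gapLen_succ]
  field_simp
  ring

theorem IsCantorData.compLen_succ_lt (h : IsCantorData n c) (k : ℕ) :
    2 * compLen n c (k + 1) < compLen n c k := by
  have h1 := h.split k
  have h2 := h.two_le_real k
  have h3 := h.compLen_pos (k + 1)
  have h4 := h.gapLen_pos k
  nlinarith [mul_nonneg (sub_nonneg.2 h2) h3.le, mul_nonneg (sub_nonneg.2 h2) h4.le]

theorem IsCantorData.compLen_strictAnti (h : IsCantorData n c) : StrictAnti (compLen n c) :=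
  strictAnti_nat_of_succ_lt fun k => by
    have := h.compLen_succ_lt k
    have := h.compLen_pos (k + 1)
    linarith

theorem IsCantorData.compLen_le_pow (h : IsCantorData n c) (k : ℕ) :
    compLen n c k ≤ (1 / 2 : ℝ) ^ k := by
  induction k with
  | zero => simp [compLen_zero]
  | succ k ih =>
    have := h.compLen_succ_lt k
    rw [pow_succ]
    linarith

theorem existsUnique_mem_mSet (h : IsCantorData n c) {k : ℕ} (hk : k ∈ Lam n c) :
    ∃! m, m ∈ mSet n c k := by
  classical
  obtain ⟨hk1, hk2⟩ := hk
  have hgap : 0 < gapLen n c k := by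
    obtain ⟨j, rfl⟩ := Nat.exists_eq_add_of_le' hk1
    exact h.gapLen_pos j
  have hex : ∃ m, compLen n c (k + m) ≤ gapLen n c k := by
    obtain ⟨m, hm⟩ := exists_pow_lt_of_lt_one hgap (by norm_num : (1 / 2 : ℝ) < 1)
    refine ⟨m, ((h.compLen_strictAnti.antitone (by omega : m ≤ k + m)).trans
      (h.compLen_le_pow m)).trans hm.le⟩
  have hpos : 1 ≤ Nat.find hex := by
    rw [Nat.one_le_iff_ne_zero]
    intro h0
    have := Nat.find_spec hex
    rw [h0, Nat.add_zero] at this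
    exact absurd hk2 (not_lt.2 this)
  refine ⟨Nat.find hex, ⟨hpos, Nat.find_spec hex, ?_⟩, ?_⟩
  · have := Nat.find_min hex (m := Nat.find hex - 1) (by omega)
    rw [Nat.add_sub_assoc hpos]
    exact not_le.1 this
  · rintro m ⟨hm1, hm2, hm3⟩
    refine le_antisymm ?_ (Nat.find_min' hex hm2)
    by_contra hlt
    have hle : k + Nat.find hex ≤ k + m - 1 := by omega
    have := h.compLen_strictAnti.antitone hle
    linarith [Nat.find_spec hex]

theorem mIdx_mem (h : IsCantorData n c) {k : ℕ} (hk : k ∈ Lam n c) :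
    mIdx n c k ∈ mSet n c k :=
  Nat.sInf_mem (existsUnique_mem_mSet h hk).exists

theorem existsUnique_mem_sSet (h : IsCantorData n c) {k : ℕ} (hk : k ∈ Lam n c) :
    ∃! s, s ∈ sSet n c k := by
  classical
  obtain ⟨hm1, hm2, -⟩ := mIdx_mem h hk
  unfold sSet
  obtain ⟨j, hj⟩ : ∃ j, k + mIdx n c k = j + 1 := ⟨k + mIdx n c k - 1, by omega⟩
  rw [hj] at hm2 ⊢
  have hd := h.compLen_pos (j + 1)
  have he := h.gapLen_pos j
  set d := compLen n c (j + 1)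
  set e := gapLen n c (j + 1)
  set g := gapLen n c k
  have hmono : ∀ a b : ℕ, a ≤ b → (a : ℝ) * (d + e) ≤ b * (d + e) := fun a b hab =>
    mul_le_mul_of_nonneg_right (by exact_mod_cast hab) (by linarith)
  have hex : ∃ s : ℕ, g < ((s : ℝ) + 1) * d + s * e := by
    obtain ⟨s, hs⟩ := exists_nat_gt (g / d)
    refine ⟨s, ?_⟩
    rw [div_lt_iff₀ hd] at hs
    have : 0 ≤ (s : ℝ) * e := by positivity
    linarith
  have hpos : 1 ≤ Nat.find hex := by
    rw [Nat.one_le_iff_ne_zero]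
    intro h0
    have := Nat.find_spec hex
    rw [h0] at this
    norm_num at this
    linarith
  refine ⟨Nat.find hex, ⟨hpos, ?_, Nat.find_spec hex⟩, ?_⟩
  · have := not_lt.1 (Nat.find_min hex (m := Nat.find hex - 1) (by omega))
    rw [Nat.cast_sub hpos] at this
    push_cast at this
    linarith
  · rintro s ⟨hs1, hs2, hs3⟩
    refine le_antisymm ?_ (Nat.find_min' hex hs3)
    by_contra hlt
    have := hmono (Nat.find hex + 1) s (by omega)
    push_cast at this
    linarith [Nat.find_spec hex]

theorem sIdx_mem (h : IsCantorData n c) {k : ℕ} (hk : k ∈ Lam n c) :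
    sIdx n c k ∈ sSet n c k :=
  Nat.sInf_mem (existsUnique_mem_sSet h hk).exists

/-- The prefix of length `k` of an infinite word. -/
def prefixWord (k : ℕ) (ω : (j : ℕ) → Fin (n (j + 1))) : Word n k := fun j => ω j

/-- The word `w` without its last letter. -/
def initWord {k : ℕ} (w : Word n (k + 1)) : Word n k := fun j => w j.castSucc

theorem leftEnd_succ {k : ℕ} (w : Word n (k + 1)) : leftEnd n c w = leftEnd n c (initWord w) +
    ((w (Fin.last k) : ℕ) : ℝ) * (compLen n c (k + 1) + gapLen n c (k + 1)) := by
  unfold leftEnd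
  rw [Fin.sum_univ_castSucc]
  rfl

theorem IsCantorData.letter_le (h : IsCantorData n c) (k : ℕ) (a : Fin (n (k + 1))) :
    ((a : ℕ) : ℝ) * (compLen n c (k + 1) + gapLen n c (k + 1)) + compLen n c (k + 1)
      ≤ compLen n c k := by
  have h1 := h.split k
  have h3 := h.compLen_pos (k + 1)
  have h4 := h.gapLen_pos k
  have h5 : ((a : ℕ) : ℝ) + 1 ≤ n (k + 1) := by exact_mod_cast a.2
  nlinarith [mul_nonneg (sub_nonneg.2 h5) (add_pos h3 h4).le]

theorem IsCantorData.component_subset (h : IsCantorData n c) {k : ℕ} (w : Word n (k + 1)) :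
    component n c w ⊆ component n c (initWord w) := by
  have h3 := h.compLen_pos (k + 1)
  have h4 := h.gapLen_pos k
  have h1 := h.letter_le k (w (Fin.last k))
  have h2 : 0 ≤ ((w (Fin.last k) : ℕ) : ℝ) * (compLen n c (k + 1) + gapLen n c (k + 1)) := by
    positivity
  have h5 := leftEnd_succ (c := c) w
  exact Icc_subset_Icc (by linarith) (by linarith)

theorem IsCantorData.eq_of_mem (h : IsCantorData n c) : ∀ {k : ℕ} {w v : Word n k} {x : ℝ},
    x ∈ component n c w → x ∈ component n c v → w = v
  | 0, w, v, _, _, _ => by ext j; exact j.elim0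
  | k + 1, w, v, x, hw, hv => by
    have hi : initWord w = initWord v :=
      h.eq_of_mem (h.component_subset w hw) (h.component_subset v hv)
    have h3 := h.compLen_pos (k + 1)
    have h4 := h.gapLen_pos k
    have key : ∀ a b : ℕ, a < b → ((a : ℝ) + 1) * (compLen n c (k + 1) + gapLen n c (k + 1)) ≤
        b * (compLen n c (k + 1) + gapLen n c (k + 1)) := fun a b hab =>
      mul_le_mul_of_nonneg_right (by exact_mod_cast hab) (by linarith)
    obtain ⟨hw1, hw2⟩ := hw
    obtain ⟨hv1, hv2⟩ := hv
    rw [leftEnd_succ] at hw1 hw2 hv1 hv2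
    rw [hi] at hw1 hw2
    have hl : w (Fin.last k) = v (Fin.last k) := by
      apply Fin.ext
      rcases lt_trichotomy (w (Fin.last k) : ℕ) (v (Fin.last k) : ℕ) with hlt | heq | hlt
      · have := key _ _ hlt
        linarith
      · exact heq
      · have := key _ _ hlt
        linarith
    funext j
    refine Fin.lastCases hl (fun i => ?_) j
    exact congrFun hi i

theorem IsCantorData.leftEnd_nonneg (h : IsCantorData n c) (k : ℕ)
    (ω : (j : ℕ) → Fin (n (j + 1))) :
    0 ≤ ((ω k : ℕ) : ℝ) * (compLen n c (k + 1) + gapLen n c (k + 1)) := by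
  have h3 := h.compLen_pos (k + 1)
  have h4 := h.gapLen_pos k
  positivity

theorem leftEnd_prefixWord (k : ℕ) (ω : (j : ℕ) → Fin (n (j + 1))) :
    leftEnd n c (prefixWord k ω) = ∑ j ∈ Finset.range k,
      ((ω j : ℕ) : ℝ) * (compLen n c (j + 1) + gapLen n c (j + 1)) := by
  rw [Finset.sum_range]
  rfl

theorem IsCantorData.sum_le (h : IsCantorData n c) (ω : (j : ℕ) → Fin (n (j + 1))) (k N : ℕ)
    (hN : k ≤ N) : ∑ j ∈ Finset.range N,
      ((ω j : ℕ) : ℝ) * (compLen n c (j + 1) + gapLen n c (j + 1)) + compLen n c N ≤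
    ∑ j ∈ Finset.range k,
      ((ω j : ℕ) : ℝ) * (compLen n c (j + 1) + gapLen n c (j + 1)) + compLen n c k := by
  induction N, hN using Nat.le_induction with
  | base => exact le_rfl
  | succ N _ ih =>
    rw [Finset.sum_range_succ]
    linarith [h.letter_le N (ω N)]

theorem IsCantorData.summable (h : IsCantorData n c) (ω : (j : ℕ) → Fin (n (j + 1))) :
    Summable fun j : ℕ => ((ω j : ℕ) : ℝ) * (compLen n c (j + 1) + gapLen n c (j + 1)) := by
  refine summable_of_sum_range_le (c := 1) (fun j => h.leftEnd_nonneg j ω) fun N => ?_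
  have := h.sum_le ω 0 N (Nat.zero_le _)
  rw [Finset.range_zero, Finset.sum_empty, compLen_zero] at this
  linarith [h.compLen_pos N]

theorem IsCantorData.point_mem (h : IsCantorData n c) (ω : (j : ℕ) → Fin (n (j + 1))) (k : ℕ) :
    point n c ω ∈ component n c (prefixWord k ω) := by
  unfold component point
  rw [leftEnd_prefixWord]
  refine ⟨(h.summable ω).sum_le_tsum _ fun j _ => h.leftEnd_nonneg j ω, ?_⟩
  refine le_of_tendsto (h.summable ω).hasSum.tendsto_sum_nat ?_
  filter_upwards [Filter.eventually_ge_atTop k] with N hN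
  linarith [h.sum_le ω k N hN, h.compLen_pos N]

theorem IsCantorData.point_mem_cantorSet (h : IsCantorData n c)
    (ω : (j : ℕ) → Fin (n (j + 1))) : point n c ω ∈ cantorSet n c :=
  mem_iInter.2 fun k => mem_iUnion.2 ⟨prefixWord k ω, h.point_mem ω k⟩

theorem IsCantorData.point_mem_iff (h : IsCantorData n c) (ω : (j : ℕ) → Fin (n (j + 1)))
    {k : ℕ} (w : Word n k) : point n c ω ∈ component n c w ↔ prefixWord k ω = w :=
  ⟨fun hx => h.eq_of_mem (h.point_mem ω k) hx, fun hw => hw ▸ h.point_mem ω k⟩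

theorem measurableSet_component {k : ℕ} (w : Word n k) : MeasurableSet (component n c w) :=
  measurableSet_Icc

theorem measurableSet_cantorSet : MeasurableSet (cantorSet n c) :=
  MeasurableSet.iInter fun _ => MeasurableSet.iUnion fun w => measurableSet_component w

theorem measurable_point : Measurable (point n c) := by
  unfold point
  fun_prop

theorem isProbabilityMeasure_vecMeasure {m : ℕ} {p : Fin m → ℝ} (hp : IsPosProb p) :
    IsProbabilityMeasure (vecMeasure p) := by
  constructor
  simp only [vecMeasure, Measure.coe_finsetSum, Finset.sum_apply, Measure.smul_apply,
    measure_univ, smul_eq_mul, mul_one]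
  rw [← ENNReal.ofReal_sum_of_nonneg fun i _ => (hp.1 i).le, hp.2, ENNReal.ofReal_one]

theorem vecMeasure_singleton {m : ℕ} (p : Fin m → ℝ) (i : Fin m) :
    vecMeasure p {i} = ENNReal.ofReal (p i) := by
  simp only [vecMeasure, Measure.coe_finsetSum, Finset.sum_apply, Measure.smul_apply,
    smul_eq_mul, Measure.dirac_apply' _ (measurableSet_singleton i)]
  rw [Finset.sum_eq_single i]
  · simp
  · intro b _ hb
    simp [hb]
  · simp

variable {P : (k : ℕ) → Fin (n k) → ℝ}

theorem cantorMeasure_preimage (h : IsCantorData n c) {s : Set ℝ} (hs : MeasurableSet s) :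
    cantorMeasure n c P ((↑) ⁻¹' s) =
      (Measure.infinitePi fun j : ℕ => vecMeasure (P (j + 1))) (point n c ⁻¹' s) := by
  unfold cantorMeasure
  rw [(MeasurableEmbedding.subtype_coe measurableSet_cantorSet).comap_apply,
    Subtype.image_preimage_coe, Measure.map_apply measurable_point
      (measurableSet_cantorSet.inter hs)]
  congr 1
  ext ω
  simp [h.point_mem_cantorSet ω]

theorem isProbabilityMeasure_cantorMeasure (h : IsCantorData n c)
    (hP : ∀ k, 1 ≤ k → IsPosProb (P k)) : IsProbabilityMeasure (cantorMeasure n c P) := by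
  have : ∀ j : ℕ, IsProbabilityMeasure (vecMeasure (P (j + 1))) := fun j =>
    isProbabilityMeasure_vecMeasure (hP (j + 1) (by omega))
  constructor
  have := cantorMeasure_preimage (P := P) h MeasurableSet.univ
  rw [preimage_univ, preimage_univ] at this
  rw [this]
  exact measure_univ

theorem cantorMeasure_component_eq_prod (h : IsCantorData n c)
    (hP : ∀ k, 1 ≤ k → IsPosProb (P k)) {k : ℕ} (w : Word n k) :
    cantorMeasure n c P ((↑) ⁻¹' component n c w) =
      ∏ j : Fin k, ENNReal.ofReal (P ((j : ℕ) + 1) (w j)) := by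
  have : ∀ j : ℕ, IsProbabilityMeasure (vecMeasure (P (j + 1))) := fun j =>
    isProbabilityMeasure_vecMeasure (hP (j + 1) (by omega))
  rw [cantorMeasure_preimage h (measurableSet_component w)]
  let t : (j : ℕ) → Set (Fin (n (j + 1))) := fun j =>
    if hj : j < k then {w ⟨j, hj⟩} else Set.univ
  have ht : point n c ⁻¹' component n c w = Set.pi (Finset.range k) t := by
    ext ω
    rw [mem_preimage, h.point_mem_iff]
    constructor
    · rintro rfl j hj
      have hj : j < k := by simpa using hj
      simp [t, hj, prefixWord]
    · intro hω
      funext j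
      have := hω j (by simp)
      simpa [t, prefixWord] using this
  rw [ht, Measure.infinitePi_pi _ fun i _ => MeasurableSet.of_discrete, Finset.prod_range]
  refine Finset.prod_congr rfl fun j _ => ?_
  simp [t, vecMeasure_singleton]

/-- `μ_P(I_{wi}) = p_{k,i} μ_P(I_w)`. -/
theorem cantorMeasure_component (h : IsCantorData n c)
    (hP : ∀ k, 1 ≤ k → IsPosProb (P k)) {k : ℕ} (w : Word n (k + 1)) :
    cantorMeasure n c P ((↑) ⁻¹' component n c w) =
      ENNReal.ofReal (P (k + 1) (w (Fin.last k))) *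
        cantorMeasure n c P ((↑) ⁻¹' component n c (initWord w)) := by
  rw [cantorMeasure_component_eq_prod h hP, cantorMeasure_component_eq_prod h hP,
    Fin.prod_univ_castSucc, mul_comm]
  rfl

end Facts

end

end UniformCantor

namespace UniformCantor

open MeasureTheory Set

noncomputable section

/-! For δ_{q+1} < r ≤ δ_q, the part of B(x, r) in the level-q component of x is essentially a block
of consecutive components of level q+1. Doubling thus compares masses of blocks that overlap or
touch. Inside one parent this is condition (a). A ball may also cross a gap of level k; the two
components of level q beside that gap then act like the single vector (P_{q+1}, P_{q+1}), provided
their masses are comparable, and this is condition (b). At level k + m_k, blocks of fewer than s_k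
components are shorter than the gap, so nothing is asked of them. The bound M on m_k is needed
because a comparison across a gap costs a factor at every level between k and k + m_k.

Sufficiency. By the symmetry x ↦ 1 - x it suffices to bound the right half of B(x, 2r), which meets
at most three components of level q. `IsWeighted.own_le`, `IsWeighted.next_le` and
`IsWeighted.second_le` bound the three parts by the block inside B(x, r). Blocks are enlarged by
`BlockDoubling.le_mul`; mass is carried across a gap by `IsWeighted.gap_ratio`, where one factor C
per level gives at most C^(M+1).

Necessity. To bound one set by another, a ball seeing only the second is enlarged a bounded number
of times until it covers the first. Three or more components contain a ball of comparable size. The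
delicate case is the comparison of the two neighbours of a gap when each has only two children: a
suitable ball then sees a child on either side of the gap, and the comparison is passed one level
down (`DoublingOn.gap_step`). The descent ends at level k + m_k, where `DoublingOn.block_across_gap`
applies, after at most M steps. Then long blocks are compared by balls (`DoublingOn.block_le`,
`DoublingOn.repeat_block_le`) and short ones entry by entry (`NeighborComparable`,
`DoublingOn.cross_le`). -/

/-- The left endpoints of the components of level `q`. -/
def leftSet (n : ℕ → ℕ) (c : ℕ → ℝ) (q : ℕ) : Set ℝ :=
  range fun w : Word n q => leftEnd n c w

/-- The distance between the left endpoints of neighbouring components of level `q + 1` in a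
component of level `q`. -/
def period (n : ℕ → ℕ) (c : ℕ → ℝ) (q : ℕ) : ℝ := compLen n c (q + 1) + gapLen n c (q + 1)

/-- The interval of length `δ_q` with left endpoint `L`. -/
def piece (n : ℕ → ℕ) (c : ℕ → ℝ) (q : ℕ) (L : ℝ) : Set ℝ := Icc L (L + compLen n c q)

/-! ### Components, gaps and endpoints; the symmetry x ↦ 1 - x. -/

section Geometry

variable {n : ℕ → ℕ} {c : ℕ → ℝ}

theorem mem_leftSet_zero {L : ℝ} : L ∈ leftSet n c 0 ↔ L = 0 := by
  constructor
  · rintro ⟨w, rfl⟩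
    simp [leftEnd]
  · rintro rfl
    exact ⟨fun j => j.elim0, by simp [leftEnd]⟩

theorem exists_initWord_eq {q : ℕ} (w : Word n q) {i : ℕ} (hi : i < n (q + 1)) :
    ∃ v : Word n (q + 1), initWord v = w ∧ v (Fin.last q) = (⟨i, hi⟩ : Fin (n (q + 1))) := by
  refine ⟨Fin.snoc (α := fun j : Fin (q + 1) => Fin (n ((j : ℕ) + 1))) w
    (⟨i, hi⟩ : Fin (n (q + 1))), ?_, ?_⟩
  · funext j
    exact Fin.snoc_castSucc (α := fun j : Fin (q + 1) => Fin (n ((j : ℕ) + 1))) _ _ _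
  · exact Fin.snoc_last (α := fun j : Fin (q + 1) => Fin (n ((j : ℕ) + 1))) _ _

theorem mem_leftSet_succ {q : ℕ} {L : ℝ} : L ∈ leftSet n c (q + 1) ↔
    ∃ L' ∈ leftSet n c q, ∃ i < n (q + 1), L = L' + i * period n c q := by
  constructor
  · rintro ⟨w, rfl⟩
    exact ⟨_, ⟨initWord w, rfl⟩, w (Fin.last q), (w (Fin.last q)).2, leftEnd_succ w⟩
  · rintro ⟨_, ⟨w, rfl⟩, i, hi, rfl⟩
    obtain ⟨v, rfl, hv⟩ := exists_initWord_eq w hi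
    refine ⟨v, ?_⟩
    show leftEnd n c v = _
    rw [leftEnd_succ, hv]
    rfl

theorem child_mem_leftSet {q : ℕ} {L : ℝ} (hL : L ∈ leftSet n c q) {i : ℕ}
    (hi : i < n (q + 1)) : L + i * period n c q ∈ leftSet n c (q + 1) :=
  mem_leftSet_succ.2 ⟨L, hL, i, hi, rfl⟩

theorem exists_mem_piece {x : ℝ} (hx : x ∈ cantorSet n c) (q : ℕ) :
    ∃ L ∈ leftSet n c q, x ∈ piece n c q L := by
  obtain ⟨w, hw⟩ := mem_iUnion.1 (mem_iInter.1 hx q)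
  exact ⟨_, ⟨w, rfl⟩, hw⟩

theorem IsCantorData.left_unique (h : IsCantorData n c) {q : ℕ} {L L' x : ℝ}
    (hL : L ∈ leftSet n c q) (hL' : L' ∈ leftSet n c q) (hx : x ∈ piece n c q L)
    (hx' : x ∈ piece n c q L') : L = L' := by
  obtain ⟨w, rfl⟩ := hL
  obtain ⟨v, rfl⟩ := hL'
  rw [h.eq_of_mem (w := w) (v := v) hx hx']

theorem IsCantorData.period_pos (h : IsCantorData n c) (q : ℕ) : 0 < period n c q :=
  add_pos (h.compLen_pos _) (h.gapLen_pos q)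

theorem IsCantorData.compLen_eq (h : IsCantorData n c) (q : ℕ) :
    compLen n c q = ((n (q + 1) : ℝ) - 1) * period n c q + compLen n c (q + 1) := by
  rw [← h.split q, period]
  ring

theorem IsCantorData.mul_period_le (h : IsCantorData n c) (q : ℕ) {a b : ℕ} (hab : a ≤ b) :
    (a : ℝ) * period n c q ≤ b * period n c q :=
  mul_le_mul_of_nonneg_right (by exact_mod_cast hab) (h.period_pos q).le

theorem IsCantorData.succ_mul_period_le (h : IsCantorData n c) (q : ℕ) {a b : ℕ} (hab : a < b) :
    (a : ℝ) * period n c q + period n c q ≤ b * period n c q := by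
  have := h.mul_period_le q (Nat.succ_le_of_lt hab)
  push_cast at this
  linarith

theorem IsCantorData.child_end_le (h : IsCantorData n c) {q i : ℕ} (hi : i < n (q + 1)) :
    i * period n c q + compLen n c (q + 1) ≤ compLen n c q :=
  h.letter_le q ⟨i, hi⟩

theorem IsCantorData.child_subset (h : IsCantorData n c) {q i : ℕ} (hi : i < n (q + 1)) (L : ℝ) :
    piece n c (q + 1) (L + i * period n c q) ⊆ piece n c q L := by
  have h1 := h.child_end_le hi
  have h2 : 0 ≤ i * period n c q := mul_nonneg (Nat.cast_nonneg _) (h.period_pos q).le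
  exact Icc_subset_Icc (by linarith) (by linarith)

theorem IsCantorData.exists_mem_child (h : IsCantorData n c) {q : ℕ} {L x : ℝ}
    (hL : L ∈ leftSet n c q) (hx : x ∈ cantorSet n c) (hxL : x ∈ piece n c q L) :
    ∃ i < n (q + 1), x ∈ piece n c (q + 1) (L + i * period n c q) := by
  obtain ⟨L₁, hL₁, hx₁⟩ := exists_mem_piece hx (q + 1)
  obtain ⟨L', hL', i, hi, rfl⟩ := mem_leftSet_succ.1 hL₁
  rw [h.left_unique hL hL' hxL (h.child_subset hi L' hx₁)]
  exact ⟨i, hi, hx₁⟩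

/-- The level sets decrease, so finitely many levels may be skipped. -/
theorem IsCantorData.mem_cantorSet (h : IsCantorData n c) {x : ℝ} (q : ℕ)
    (hx : ∀ r, q ≤ r → ∃ L ∈ leftSet n c r, x ∈ piece n c r L) : x ∈ cantorSet n c := by
  have anti : Antitone (levelSet n c) := antitone_nat_of_succ_le fun k => by
    rintro y hy
    obtain ⟨w, hw⟩ := mem_iUnion.1 hy
    exact mem_iUnion.2 ⟨initWord w, h.component_subset w hw⟩
  refine mem_iInter.2 fun k => anti (le_max_left k q) ?_
  obtain ⟨_, ⟨w, rfl⟩, hw⟩ := hx (max k q) (le_max_right _ _)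
  exact mem_iUnion.2 ⟨w, hw⟩

theorem IsCantorData.left_mem_leftSet (h : IsCantorData n c) {q : ℕ} {L : ℝ}
    (hL : L ∈ leftSet n c q) {r : ℕ} (hr : q ≤ r) : L ∈ leftSet n c r := by
  induction r, hr using Nat.le_induction with
  | base => exact hL
  | succ r _ ih =>
    have := child_mem_leftSet ih (i := 0) (by have := h.two_le (r + 1) (by omega); omega)
    simpa using this

theorem IsCantorData.right_sub_mem_leftSet (h : IsCantorData n c) {q : ℕ} {z : ℝ}
    (hL : z - compLen n c q ∈ leftSet n c q) {r : ℕ} (hr : q ≤ r) :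
    z - compLen n c r ∈ leftSet n c r := by
  induction r, hr using Nat.le_induction with
  | base => exact hL
  | succ r _ ih =>
    have h2 := h.two_le (r + 1) (by omega)
    have := child_mem_leftSet ih (i := n (r + 1) - 1) (by omega)
    rw [h.compLen_eq r, Nat.cast_sub (by omega)] at this
    convert this using 1
    push_cast
    ring

/-- Endpoints persist as endpoints at all deeper levels. They serve as centres of balls when the
doubling property is applied. -/
theorem IsCantorData.left_mem_cantorSet (h : IsCantorData n c) {q : ℕ} {L : ℝ}
    (hL : L ∈ leftSet n c q) : L ∈ cantorSet n c :=
  h.mem_cantorSet q fun r hr => ⟨L, h.left_mem_leftSet hL hr, le_rfl,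
    le_add_of_nonneg_right (h.compLen_pos r).le⟩

theorem IsCantorData.right_mem_cantorSet (h : IsCantorData n c) {q : ℕ} {z : ℝ}
    (hL : z - compLen n c q ∈ leftSet n c q) : z ∈ cantorSet n c :=
  h.mem_cantorSet q fun r hr => ⟨_, h.right_sub_mem_leftSet hL hr,
    sub_le_self _ (h.compLen_pos r).le, by simp⟩

theorem cantorSet_subset {x : ℝ} (hx : x ∈ cantorSet n c) : 0 ≤ x ∧ x ≤ 1 := by
  obtain ⟨L, hL, hxL⟩ := exists_mem_piece hx 0
  rw [mem_leftSet_zero.1 hL, piece, compLen_zero] at hxL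
  exact ⟨hxL.1, by linarith [hxL.2]⟩

/-- `(z, z + ε_{j+1})` is a gap of level `j + 1`. -/
def IsGap (n : ℕ → ℕ) (c : ℕ → ℝ) (j : ℕ) (z : ℝ) : Prop :=
  ∃ L ∈ leftSet n c j, ∃ i, i + 1 < n (j + 1) ∧ z = L + i * period n c j + compLen n c (j + 1)

theorem IsCantorData.gap_right_mem (h : IsCantorData n c) {j q : ℕ} {z : ℝ}
    (hz : IsGap n c j z) (hq : j + 1 ≤ q) : z + gapLen n c (j + 1) ∈ leftSet n c q := by
  obtain ⟨L, hL, i, hi, rfl⟩ := hz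
  refine h.left_mem_leftSet (q := j + 1) ?_ hq
  have := child_mem_leftSet hL hi
  convert this using 1
  push_cast
  rw [period]
  ring

theorem IsCantorData.gap_left_mem (h : IsCantorData n c) {j q : ℕ} {z : ℝ}
    (hz : IsGap n c j z) (hq : j + 1 ≤ q) : z - compLen n c q ∈ leftSet n c q := by
  obtain ⟨L, hL, i, hi, rfl⟩ := hz
  refine h.right_sub_mem_leftSet (q := j + 1) ?_ hq
  simpa using child_mem_leftSet hL (show i < n (j + 1) by omega)

theorem IsCantorData.gap_empty (h : IsCantorData n c) {j : ℕ} {z u : ℝ} (hz : IsGap n c j z)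
    (hu : u ∈ cantorSet n c) : u ≤ z ∨ z + gapLen n c (j + 1) ≤ u := by
  obtain ⟨L, hL, i, hi, rfl⟩ := hz
  by_contra! hcon
  have h1 := h.child_end_le hi
  have h2 : 0 ≤ i * period n c j := mul_nonneg (Nat.cast_nonneg _) (h.period_pos j).le
  have h3 := h.compLen_pos (j + 1)
  have h4 : period n c j = compLen n c (j + 1) + gapLen n c (j + 1) := rfl
  push_cast at h1
  obtain ⟨i', hi', hu'⟩ := h.exists_mem_child hL hu ⟨by linarith, by linarith⟩
  rcases Nat.lt_or_ge i i' with hlt | hle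
  · have := h.succ_mul_period_le j hlt
    linarith [hu'.1]
  · have := h.mul_period_le j hle
    linarith [hu'.2]

/-- A component is the last one or it has a gap at its right end. -/
theorem IsCantorData.last_or_gap (h : IsCantorData n c) {q : ℕ} {L : ℝ}
    (hL : L ∈ leftSet n c q) : (∀ u ∈ cantorSet n c, u ≤ L + compLen n c q) ∨
      ∃ j, j + 1 ≤ q ∧ IsGap n c j (L + compLen n c q) := by
  induction q generalizing L with
  | zero =>
    left
    intro u hu
    rw [mem_leftSet_zero.1 hL, compLen_zero, zero_add]
    exact (cantorSet_subset hu).2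
  | succ q ih =>
    obtain ⟨L', hL', i, hi, rfl⟩ := mem_leftSet_succ.1 hL
    by_cases hlast : i + 1 < n (q + 1)
    · exact Or.inr ⟨q, le_rfl, L', hL', i, hlast, rfl⟩
    -- A last child ends where its parent ends, so the question passes to the parent.
    · have hi' : (n (q + 1) : ℝ) = i + 1 := by exact_mod_cast (by omega : n (q + 1) = i + 1)
      have he := h.compLen_eq q
      have : L' + i * period n c q + compLen n c (q + 1) = L' + compLen n c q := by
        rw [he, hi']
        ring
      rw [this]
      rcases ih hL' with h1 | ⟨j, hj, hg⟩
      · exact Or.inl h1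
      · exact Or.inr ⟨j, by omega, hg⟩

/-- The construction is symmetric about 1/2, with letter i replaced by n - 1 - i. This lets every
later estimate be proved on one side only. -/
theorem IsCantorData.reflect_left (h : IsCantorData n c) {q : ℕ} {L : ℝ}
    (hL : L ∈ leftSet n c q) : 1 - L - compLen n c q ∈ leftSet n c q := by
  induction q generalizing L with
  | zero => simp [mem_leftSet_zero, mem_leftSet_zero.1 hL, compLen_zero]
  | succ q ih =>
    obtain ⟨L', hL', i, hi, rfl⟩ := mem_leftSet_succ.1 hL
    have := child_mem_leftSet (ih hL') (i := n (q + 1) - 1 - i) (by omega)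
    rw [h.compLen_eq q, Nat.cast_sub (by omega), Nat.cast_sub (by omega)] at this
    convert this using 1
    push_cast
    ring

theorem IsCantorData.reflect_mem (h : IsCantorData n c) {x : ℝ} (hx : x ∈ cantorSet n c) :
    1 - x ∈ cantorSet n c := by
  refine h.mem_cantorSet 0 fun r _ => ?_
  obtain ⟨L, hL, h1, h2⟩ := exists_mem_piece hx r
  exact ⟨_, h.reflect_left hL, by linarith, by linarith⟩

theorem IsCantorData.reflect_gap (h : IsCantorData n c) {j : ℕ} {z : ℝ} (hz : IsGap n c j z) :
    IsGap n c j (1 - z - gapLen n c (j + 1)) := by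
  obtain ⟨L, hL, i, hi, rfl⟩ := hz
  refine ⟨_, h.reflect_left hL, n (j + 1) - 2 - i, by omega, ?_⟩
  rw [h.compLen_eq j, Nat.cast_sub (by omega), Nat.cast_sub (by omega), period]
  push_cast
  ring

end Geometry

/-! ### Measures with prescribed relative weights of the components -/

/-- `ν` is a probability measure on the uniform Cantor set which distributes the mass of a
component of level `q` among its sub-components according to the weights `p (q + 1)`. -/
structure IsWeighted (n : ℕ → ℕ) (c : ℕ → ℝ) (p : ℕ → ℕ → ℝ) (ν : Measure ℝ) : Prop where
  data : IsCantorData n c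
  pos : ∀ q i, i < n (q + 1) → 0 < p (q + 1) i
  sum_eq : ∀ q, ∑ i ∈ Finset.range (n (q + 1)), p (q + 1) i = 1
  prob : IsProbabilityMeasure ν
  null : ν (cantorSet n c)ᶜ = 0
  child : ∀ q, ∀ L ∈ leftSet n c q, ∀ i < n (q + 1),
    ν.real (piece n c (q + 1) (L + i * period n c q)) = p (q + 1) i * ν.real (piece n c q L)

/-- The weights in reversed order. -/
def reflectWeight (n : ℕ → ℕ) (p : ℕ → ℕ → ℝ) (k i : ℕ) : ℝ := p k (n k - 1 - i)

section Weighted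

variable {n : ℕ → ℕ} {c : ℕ → ℝ} {p : ℕ → ℕ → ℝ} {ν : Measure ℝ}

/-- Only points of the Cantor set count, since its complement is null. -/
theorem IsWeighted.mono (h : IsWeighted n c p ν) {S T : Set ℝ}
    (hST : ∀ u ∈ cantorSet n c, u ∈ S → u ∈ T) : ν.real S ≤ ν.real T := by
  have := h.prob
  have h1 : ν S ≤ ν T := by
    refine measure_mono_ae ?_
    have h2 : ∀ᵐ u ∂ν, u ∈ cantorSet n c := h.null
    filter_upwards [h2] with u hu hS using hST u hu hS
  exact ENNReal.toReal_mono (measure_ne_top _ _) h1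

/-- Together with `IsWeighted.sum_le`, this turns masses into sums of weights: one bound by
covering, the other by packing disjoint children. -/
theorem IsWeighted.le_sum (h : IsWeighted n c p ν) {q : ℕ} {L : ℝ} (hL : L ∈ leftSet n c q)
    {F : Finset ℕ} (hF : ∀ i ∈ F, i < n (q + 1)) {S : Set ℝ}
    (hS : ∀ u ∈ cantorSet n c, u ∈ S → ∃ i ∈ F, u ∈ piece n c (q + 1) (L + i * period n c q)) :
    ν.real S ≤ (∑ i ∈ F, p (q + 1) i) * ν.real (piece n c q L) := by
  have := h.prob
  calc ν.real S ≤ ν.real (⋃ i ∈ F, piece n c (q + 1) (L + i * period n c q)) :=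
        h.mono fun u hu hS' => by simpa using hS u hu hS'
    _ ≤ ∑ i ∈ F, ν.real (piece n c (q + 1) (L + i * period n c q)) :=
        measureReal_biUnion_finset_le _ _
    _ = _ := by
        rw [Finset.sum_mul]
        exact Finset.sum_congr rfl fun i hi => h.child q L hL i (hF i hi)

theorem IsWeighted.sum_le (h : IsWeighted n c p ν) {q : ℕ} {L : ℝ} (hL : L ∈ leftSet n c q)
    {F : Finset ℕ} (hF : ∀ i ∈ F, i < n (q + 1)) {S : Set ℝ}
    (hS : ∀ i ∈ F, piece n c (q + 1) (L + i * period n c q) ⊆ S) :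
    (∑ i ∈ F, p (q + 1) i) * ν.real (piece n c q L) ≤ ν.real S := by
  have := h.prob
  have hd : ∀ a b : ℕ, a < b → Disjoint (piece n c (q + 1) (L + a * period n c q))
      (piece n c (q + 1) (L + b * period n c q)) := by
    intro a b hab
    rw [Set.disjoint_left]
    intro u hu hu'
    have h1 := h.data.succ_mul_period_le q hab
    have h2 := h.data.gapLen_pos q
    have h3 : period n c q = compLen n c (q + 1) + gapLen n c (q + 1) := rfl
    linarith [hu.2, hu'.1]
  calc (∑ i ∈ F, p (q + 1) i) * ν.real (piece n c q L)
      = ∑ i ∈ F, ν.real (piece n c (q + 1) (L + i * period n c q)) := by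
        rw [Finset.sum_mul]
        exact Finset.sum_congr rfl fun i hi => (h.child q L hL i (hF i hi)).symm
    _ = ν.real (⋃ i ∈ F, piece n c (q + 1) (L + i * period n c q)) := by
        rw [measureReal_biUnion_finset]
        · intro a _ b _ hab
          rcases lt_or_gt_of_ne hab with hlt | hlt
          · exact hd a b hlt
          · exact (hd b a hlt).symm
        · exact fun i _ => measurableSet_Icc
    _ ≤ ν.real S := measureReal_mono (iUnion₂_subset hS)

theorem IsWeighted.piece_zero (h : IsWeighted n c p ν) : ν.real (piece n c 0 0) = 1 := by
  have := h.prob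
  refine le_antisymm measureReal_le_one ?_
  rw [← probReal_univ (μ := ν)]
  refine h.mono fun u hu _ => ?_
  have := cantorSet_subset hu
  rw [piece, compLen_zero]
  exact ⟨this.1, by linarith⟩

theorem IsWeighted.piece_pos (h : IsWeighted n c p ν) {q : ℕ} {L : ℝ} (hL : L ∈ leftSet n c q) :
    0 < ν.real (piece n c q L) := by
  induction q generalizing L with
  | zero => rw [mem_leftSet_zero.1 hL, h.piece_zero]; exact one_pos
  | succ q ih =>
    obtain ⟨L', hL', i, hi, rfl⟩ := mem_leftSet_succ.1 hL
    rw [h.child q L' hL' i hi]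
    exact mul_pos (h.pos q i hi) (ih hL')

theorem measurableSet_piece (q : ℕ) (L : ℝ) : MeasurableSet (piece n c q L) :=
  measurableSet_Icc

theorem map_reflect_real (ν : Measure ℝ) (q : ℕ) (L : ℝ) :
    (ν.map fun x => 1 - x).real (piece n c q L) =
      ν.real (piece n c q (1 - L - compLen n c q)) := by
  rw [map_measureReal_apply (by fun_prop) (measurableSet_piece q L)]
  congr 1
  ext x
  simp only [piece, mem_preimage, mem_Icc]
  constructor <;> rintro ⟨h1, h2⟩ <;> constructor <;> linarith

theorem IsWeighted.reflect (h : IsWeighted n c p ν) :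
    IsWeighted n c (reflectWeight n p) (ν.map fun x => 1 - x) where
  data := h.data
  pos q i hi := h.pos q _ (by omega)
  sum_eq q := by
    rw [← h.sum_eq q]
    exact Finset.sum_range_reflect (fun i => p (q + 1) i) (n (q + 1))
  prob := by
    have := h.prob
    exact Measure.isProbabilityMeasure_map (by fun_prop)
  null := by
    rw [Measure.map_apply (by fun_prop) measurableSet_cantorSet.compl, ← nonpos_iff_eq_zero,
      ← h.null]
    refine measure_mono fun x hx hxE => hx (h.data.reflect_mem hxE)
  child q L hL i hi := by
    rw [map_reflect_real, map_reflect_real, reflectWeight,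
      ← h.child q _ (h.data.reflect_left hL) _ (by omega)]
    congr 2
    rw [h.data.compLen_eq q, Nat.cast_sub (by omega), Nat.cast_sub (by omega)]
    push_cast
    ring

end Weighted

/-! ### Doubling vectors -/

/-- Blocks of equal length `l ≥ s` which overlap or touch have comparable sums. -/
def BlockDoubling (C : ℝ) (s m : ℕ) (f : ℕ → ℝ) : Prop :=
  ∀ i j l : ℕ, s ≤ l → i ≤ j → j ≤ i + l → j + l ≤ m →
    ∑ a ∈ Finset.Ico i (i + l), f a ≤ C * ∑ a ∈ Finset.Ico j (j + l), f a ∧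
    ∑ a ∈ Finset.Ico j (j + l), f a ≤ C * ∑ a ∈ Finset.Ico i (i + l), f a

/-- The entries of a vector, continued by `0`. -/
def entry {m : ℕ} (v : Fin m → ℝ) (i : ℕ) : ℝ := if hi : i < m then v ⟨i, hi⟩ else 0

/-- The sequence `f 0, …, f (m - 1), f 0, f 1, …`. -/
def repeatSeq (m : ℕ) (f : ℕ → ℝ) (i : ℕ) : ℝ := if i < m then f i else f (i - m)

theorem entry_pos {m : ℕ} {v : Fin m → ℝ} (hv : ∀ i, 0 < v i) {i : ℕ} (hi : i < m) :
    0 < entry v i := by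
  rw [entry, dif_pos hi]
  exact hv _

theorem entry_twice {m : ℕ} (v : Fin m → ℝ) {i : ℕ} (hi : i < m + m) :
    entry (twice v) i = repeatSeq m (entry v) i := by
  rw [entry, dif_pos hi, repeatSeq, twice]
  split_ifs with h
  · have : (⟨i, hi⟩ : Fin (m + m)) = Fin.castAdd m ⟨i, h⟩ := rfl
    rw [this, Fin.append_left, entry, dif_pos h]
  · have : (⟨i, hi⟩ : Fin (m + m)) = Fin.natAdd m ⟨i - m, by omega⟩ := by
      ext
      simp
      omega
    rw [this, Fin.append_right, entry, dif_pos (by omega)]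

theorem blockSum_eq {m : ℕ} (v : Fin m → ℝ) {i l : ℕ} (h : i + l ≤ m) :
    blockSum v i l = ∑ a ∈ Finset.Ico i (i + l), entry v a := by
  unfold blockSum
  refine Finset.sum_bij (fun a _ => (a : ℕ)) ?_ ?_ ?_ ?_
  · intro a ha
    simpa using ha
  · intro a _ b _ hab
    exact Fin.ext hab
  · intro b hb
    rw [Finset.mem_Ico] at hb
    exact ⟨⟨b, by omega⟩, by simpa using hb, rfl⟩
  · intro a _
    rw [entry, dif_pos a.2]

/-- As s ≥ 1, the blocks are nonempty with positive sums, so the bounds on ratios can be multiplied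
out. The condition l ≤ m is implied by j + l ≤ m. -/
theorem isUniformFrom_iff {m : ℕ} {v : Fin m → ℝ} (hv : ∀ i, 0 < v i) {C : ℝ} (hC : 0 < C)
    {s : ℕ} (hs : 1 ≤ s) : IsUniformFrom C s v ↔ BlockDoubling C s m (entry v) := by
  have hpos : ∀ i l : ℕ, s ≤ l → i + l ≤ m → 0 < ∑ a ∈ Finset.Ico i (i + l), entry v a := by
    intro i l hl him
    refine Finset.sum_pos (fun a ha => entry_pos hv ?_) ⟨i, ?_⟩
    · rw [Finset.mem_Ico] at ha
      omega
    · rw [Finset.mem_Ico]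
      omega
  have key : ∀ {A B : ℝ}, 0 < A → 0 < B →
      ((C⁻¹ ≤ A / B ∧ A / B ≤ C) ↔ (A ≤ C * B ∧ B ≤ C * A)) := by
    intro A B hA hB
    rw [div_le_iff₀ hB, le_div_iff₀ hB, inv_mul_le_iff₀ hC]
    exact and_comm
  constructor
  · intro H i j l h1 h3 h4 h5
    have := H i j l h1 (by omega) h3 h4 h5
    rw [blockSum_eq v (by omega), blockSum_eq v h5] at this
    exact (key (hpos i l h1 (by omega)) (hpos j l h1 h5)).1 this
  · intro H i j l h1 _ h3 h4 h5
    rw [blockSum_eq v (by omega), blockSum_eq v h5]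
    exact (key (hpos i l h1 (by omega)) (hpos j l h1 h5)).2 (H i j l h1 h3 h4 h5)

theorem BlockDoubling.congr {C : ℝ} {s m : ℕ} {f g : ℕ → ℝ} (h : BlockDoubling C s m f)
    (hfg : ∀ i < m, f i = g i) : BlockDoubling C s m g := by
  have key : ∀ i l : ℕ, i + l ≤ m →
      ∑ a ∈ Finset.Ico i (i + l), g a = ∑ a ∈ Finset.Ico i (i + l), f a := by
    intro i l him
    refine Finset.sum_congr rfl fun a ha => (hfg a ?_).symm
    rw [Finset.mem_Ico] at ha
    omega
  intro i j l h1 h2 h3 h4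
  rw [key i l (by omega), key j l h4]
  exact h i j l h1 h2 h3 h4

theorem BlockDoubling.reflect {C : ℝ} {s m : ℕ} {f : ℕ → ℝ} (h : BlockDoubling C s m f) :
    BlockDoubling C s m fun i => f (m - 1 - i) := by
  have key : ∀ i l : ℕ, i + l ≤ m → ∑ a ∈ Finset.Ico i (i + l), f (m - 1 - a) =
      ∑ a ∈ Finset.Ico (m - i - l) (m - i - l + l), f a := by
    intro i l him
    refine Finset.sum_bij' (fun a _ => m - 1 - a) (fun a _ => m - 1 - a) ?_ ?_ ?_ ?_ ?_ <;>
      intro a ha <;> rw [Finset.mem_Ico] at ha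
    · rw [Finset.mem_Ico]; omega
    · rw [Finset.mem_Ico]; omega
    · omega
    · omega
  intro i j l h1 h2 h3 h4
  rw [key i l (by omega), key j l h4]
  exact (h (m - j - l) (m - i - l) l h1 (by omega) (by omega) (by omega)).symm

/-- A block of length l is extended by l on both sides, cut off at the ends of the vector. Each
extension lies in a block of length l that overlaps or touches the old one, so one round costs 1 +
2C; N rounds reach every index within N l. -/
theorem BlockDoubling.le_mul {C : ℝ} {s m : ℕ} {f : ℕ → ℝ} (h : BlockDoubling C s m f)
    (hC : 0 ≤ C) (hf : ∀ i < m, 0 ≤ f i) (N : ℕ) {a l : ℕ} (hs : s ≤ l) (ham : a + l ≤ m)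
    {F : Finset ℕ} (hF : ∀ i ∈ F, i < m ∧ a ≤ i + N * l ∧ i < a + l + N * l) :
    ∑ i ∈ F, f i ≤ (1 + 2 * C) ^ N * ∑ i ∈ Finset.Ico a (a + l), f i := by
  have mono : ∀ {A B : Finset ℕ}, A ⊆ B → (∀ i ∈ B, i < m) → ∑ i ∈ A, f i ≤ ∑ i ∈ B, f i :=
    fun hAB hB => Finset.sum_le_sum_of_subset_of_nonneg hAB fun i hi _ => hf i (hB i hi)
  induction N generalizing a l with
  | zero =>
    rw [pow_zero, one_mul]
    refine mono (fun i hi => ?_) (fun i hi => ?_)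
    · have := hF i hi
      rw [Finset.mem_Ico]
      omega
    · rw [Finset.mem_Ico] at hi
      omega
  | succ N ih =>
    obtain ⟨b, hb⟩ : ∃ b, b = min m (a + l + l) := ⟨_, rfl⟩
    obtain ⟨a', ha'⟩ : ∃ a', a' = a - l := ⟨_, rfl⟩
    have hl : l ≤ b - a' := by omega
    have hNl : N * l ≤ N * (b - a') := Nat.mul_le_mul_left N hl
    have h1 := ih (a := a') (l := b - a') (by omega) (by omega) fun i hi => by
      have := hF i hi
      rw [add_mul, one_mul] at this
      omega
    refine h1.trans ?_
    rw [pow_succ, mul_assoc]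
    refine mul_le_mul_of_nonneg_left ?_ (by positivity)
    have hleft : ∑ i ∈ Finset.Ico a' a, f i ≤ C * ∑ i ∈ Finset.Ico a (a + l), f i := by
      refine (mono (B := Finset.Ico a' (a' + l)) ?_ ?_).trans
        (h a' a l hs (by omega) (by omega) ham).1
      · exact Finset.Ico_subset_Ico_right (by omega)
      · intro i hi
        rw [Finset.mem_Ico] at hi
        omega
    -- The comparison block ends at b, rather than starting at a + l, because the latter might leave
    -- the vector.
    have hright : ∑ i ∈ Finset.Ico (a + l) b, f i ≤ C * ∑ i ∈ Finset.Ico a (a + l), f i := by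
      refine (mono (B := Finset.Ico (b - l) (b - l + l)) ?_ ?_).trans
        (h a (b - l) l hs (by omega) (by omega) (by omega)).2
      · exact Finset.Ico_subset_Ico (by omega) (by omega)
      · intro i hi
        rw [Finset.mem_Ico] at hi
        omega
    rw [show a' + (b - a') = b by omega,
      ← Finset.sum_Ico_consecutive f (show a' ≤ a by omega) (show a ≤ b by omega),
      ← Finset.sum_Ico_consecutive f (show a ≤ a + l by omega) (show a + l ≤ b by omega)]
    linarith

/-! ### Uniform weights give a doubling measure -/

/-- The uniformness conditions on the weights. -/
structure UniformWeights (n : ℕ → ℕ) (c : ℕ → ℝ) (p : ℕ → ℕ → ℝ) (C : ℝ) : Prop where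
  single : ∀ q, BlockDoubling C 1 (n (q + 1)) (p (q + 1))
  inner : ∀ k ∈ Lam n c, ∀ t, 1 ≤ t → t < mIdx n c k →
    BlockDoubling C 1 (n (k + t) + n (k + t)) (repeatSeq (n (k + t)) (p (k + t)))
  last : ∀ k ∈ Lam n c, BlockDoubling C (sIdx n c k)
    (n (k + mIdx n c k) + n (k + mIdx n c k))
    (repeatSeq (n (k + mIdx n c k)) (p (k + mIdx n c k)))

section Sufficiency

variable {n : ℕ → ℕ} {c : ℕ → ℝ} {p : ℕ → ℕ → ℝ} {ν : Measure ℝ} {C : ℝ}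

theorem repeatSeq_reflect {m : ℕ} (f : ℕ → ℝ) {i : ℕ} (hi : i < m + m) :
    repeatSeq m f (m + m - 1 - i) = repeatSeq m (fun a => f (m - 1 - a)) i := by
  unfold repeatSeq
  split_ifs with h1 h2 h2
  · omega
  · congr 1; omega
  · congr 1; omega
  · omega

theorem UniformWeights.reflect (U : UniformWeights n c p C) :
    UniformWeights n c (reflectWeight n p) C where
  single q := (U.single q).reflect
  inner k hk t h1 h2 := (U.inner k hk t h1 h2).reflect.congr fun _ hi => repeatSeq_reflect _ hi
  last k hk := (U.last k hk).reflect.congr fun _ hi => repeatSeq_reflect _ hi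

/-! ### Masses of the components on the two sides of a gap. -/

theorem BlockDoubling.succ_le {s m : ℕ} {f : ℕ → ℝ} (h : BlockDoubling C s m f) (hs : s ≤ 1)
    {i : ℕ} (hi : i + 1 < m) : f (i + 1) ≤ C * f i := by
  have := (h i (i + 1) 1 hs (by omega) le_rfl (by omega)).2
  simpa using this

theorem IsWeighted.gap_right_succ (h : IsWeighted n c p ν) {j q : ℕ} {z : ℝ}
    (hz : IsGap n c j z) (hq : j + 1 ≤ q) :
    ν.real (piece n c (q + 1) (z + gapLen n c (j + 1))) =
      p (q + 1) 0 * ν.real (piece n c q (z + gapLen n c (j + 1))) := by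
  have h2 := h.data.two_le (q + 1) (by omega)
  have := h.child q _ (h.data.gap_right_mem hz hq) 0 (by omega)
  simpa using this

theorem IsCantorData.last_child (h : IsCantorData n c) (q : ℕ) (z : ℝ) :
    z - compLen n c q + ((n (q + 1) - 1 : ℕ) : ℝ) * period n c q = z - compLen n c (q + 1) := by
  have h2 := h.two_le (q + 1) (by omega)
  rw [h.compLen_eq q, Nat.cast_sub (by omega)]
  push_cast
  ring

theorem IsWeighted.gap_left_succ (h : IsWeighted n c p ν) {j q : ℕ} {z : ℝ}
    (hz : IsGap n c j z) (hq : j + 1 ≤ q) :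
    ν.real (piece n c (q + 1) (z - compLen n c (q + 1))) =
      p (q + 1) (n (q + 1) - 1) * ν.real (piece n c q (z - compLen n c q)) := by
  have h2 := h.data.two_le (q + 1) (by omega)
  have := h.child q _ (h.data.gap_left_mem hz hq) (n (q + 1) - 1) (by omega)
  rwa [h.data.last_child] at this

theorem IsWeighted.gap_first (h : IsWeighted n c p ν) {j i : ℕ} {L : ℝ} (hL : L ∈ leftSet n c j)
    (hi : i + 1 < n (j + 1)) {z : ℝ} (hz : z = L + i * period n c j + compLen n c (j + 1)) :
    ν.real (piece n c (j + 1) (z + gapLen n c (j + 1))) =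
      p (j + 1) (i + 1) * ν.real (piece n c j L) ∧
    ν.real (piece n c (j + 1) (z - compLen n c (j + 1))) =
      p (j + 1) i * ν.real (piece n c j L) := by
  rw [← h.child j L hL (i + 1) hi, ← h.child j L hL i (by omega), hz]
  constructor
  · congr 2
    push_cast
    rw [period]
    ring
  · congr 2
    ring

theorem IsCantorData.lt_add_mIdx (h : IsCantorData n c) {k q : ℕ} (hk : k ∈ Lam n c)
    (hq : gapLen n c k < compLen n c q) : q < k + mIdx n c k := by
  obtain ⟨-, h2, -⟩ := mIdx_mem h hk
  by_contra hle
  have := h.compLen_strictAnti.antitone (not_lt.1 hle)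
  linarith

/-- Going one level down multiplies the right mass by the first weight and the left mass by the last
one. These are adjacent entries of (P, P), so each level costs a factor C. -/
theorem IsWeighted.gap_ratio_pow (h : IsWeighted n c p ν) (U : UniformWeights n c p C)
    (hC : 1 ≤ C) {j : ℕ} {z : ℝ} (hz : IsGap n c j z) {q : ℕ} (hq : j + 1 ≤ q)
    (hlt : gapLen n c (j + 1) < 2 * compLen n c q) :
    ν.real (piece n c q (z + gapLen n c (j + 1))) ≤
      C ^ (q - j) * ν.real (piece n c q (z - compLen n c q)) := by
  induction q, hq using Nat.le_induction with
  | base =>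
    obtain ⟨L, hL, i, hi, hz⟩ := hz
    obtain ⟨h1, h2⟩ := h.gap_first hL hi hz
    rw [h1, h2, show j + 1 - j = 1 by omega, pow_one, ← mul_assoc]
    exact mul_le_mul_of_nonneg_right ((U.single j).succ_le le_rfl hi) measureReal_nonneg
  | succ q hq ih =>
    have hd := h.data.compLen_succ_lt q
    have hd' := h.data.compLen_pos (q + 1)
    have h2 := h.data.two_le (q + 1) (by omega)
    have hk : j + 1 ∈ Lam n c :=
      ⟨by omega, by linarith [h.data.compLen_strictAnti.antitone hq]⟩
    have hqm := h.data.lt_add_mIdx hk (q := q) (by linarith)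
    have hp : p (q + 1) 0 ≤ C * p (q + 1) (n (q + 1) - 1) := by
      have e1 : repeatSeq (n (q + 1)) (p (q + 1)) (n (q + 1) - 1 + 1) = p (q + 1) 0 := by
        rw [repeatSeq, if_neg (by omega)]
        congr 1
        omega
      have e2 : repeatSeq (n (q + 1)) (p (q + 1)) (n (q + 1) - 1) =
          p (q + 1) (n (q + 1) - 1) := by
        rw [repeatSeq, if_pos (by omega)]
      rw [← e1, ← e2]
      rcases Nat.lt_or_ge (q + 1) (j + 1 + mIdx n c (j + 1)) with hlt' | hge
      · have hB := U.inner _ hk (q + 1 - (j + 1)) (by omega) (by omega)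
        rw [show j + 1 + (q + 1 - (j + 1)) = q + 1 by omega] at hB
        exact hB.succ_le le_rfl (by omega)
      · have heq : j + 1 + mIdx n c (j + 1) = q + 1 := by omega
        have hB := U.last _ hk
        obtain ⟨-, hs2, -⟩ := sIdx_mem h.data hk
        rw [heq] at hB hs2
        refine hB.succ_le ?_ (by omega)
        -- At level k + m_k only s_k-blocks are controlled, but s_k = 1 here: s_k ≥ 2 would give 2
        -- δ_{q+1} ≤ ε_k, against the hypothesis.
        by_contra hs
        have hs : (2 : ℝ) ≤ sIdx n c (j + 1) := by exact_mod_cast (by omega)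
        have := h.data.gapLen_pos q
        nlinarith
    rw [h.gap_right_succ hz hq, h.gap_left_succ hz hq, show q + 1 - j = (q - j) + 1 by omega,
      pow_succ]
    have hpos := h.pos q (n (q + 1) - 1) (by omega)
    calc p (q + 1) 0 * ν.real (piece n c q (z + gapLen n c (j + 1)))
        ≤ (C * p (q + 1) (n (q + 1) - 1)) *
          (C ^ (q - j) * ν.real (piece n c q (z - compLen n c q))) :=
          mul_le_mul hp (ih (by linarith)) measureReal_nonneg (by positivity)
      _ = _ := by ring

/-- If q > j + 1, then ε_{j+1} < 2 δ_q < δ_{q-1}. So q - 1 < j + 1 + m_{j+1}, which makes the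
exponent q - j at most M + 1. -/
theorem IsWeighted.gap_ratio (h : IsWeighted n c p ν) (U : UniformWeights n c p C)
    (hC : 1 ≤ C) {M : ℕ} (hM : ∀ k ∈ Lam n c, mIdx n c k ≤ M) {j : ℕ} {z : ℝ}
    (hz : IsGap n c j z) {q : ℕ} (hq : j + 1 ≤ q)
    (hlt : gapLen n c (j + 1) < 2 * compLen n c q) :
    ν.real (piece n c q (z + gapLen n c (j + 1))) ≤
      C ^ (M + 1) * ν.real (piece n c q (z - compLen n c q)) := by
  refine (h.gap_ratio_pow U hC hz hq hlt).trans
    (mul_le_mul_of_nonneg_right (pow_le_pow_right₀ hC ?_) measureReal_nonneg)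
  rcases Nat.eq_or_lt_of_le hq with heq | hlt'
  · omega
  · obtain ⟨r, rfl⟩ : ∃ r, q = r + 1 := ⟨q - 1, by omega⟩
    have hd := h.data.compLen_succ_lt r
    have hk : j + 1 ∈ Lam n c :=
      ⟨by omega, by linarith [h.data.compLen_strictAnti.antitone (show j + 1 ≤ r by omega)]⟩
    have := h.data.lt_add_mIdx hk (q := r) (by linarith)
    have := hM _ hk
    omega

/-- A ball of radius `r`, `l h + δ < r`, around a point of a component contains the `l`
neighbours on either side in the same parent. -/
theorem IsWeighted.exists_block (h : IsWeighted n c p ν) {q : ℕ} {L x r : ℝ}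
    (hL : L ∈ leftSet n c q) {i₀ l : ℕ} (hi₀ : i₀ < n (q + 1))
    (hx : x ∈ piece n c (q + 1) (L + i₀ * period n c q))
    (hr : l * period n c q + compLen n c (q + 1) < r) :
    ∃ a b, a + b ≤ n (q + 1) ∧ a ≤ i₀ ∧ i₀ < a + b ∧ (l + 1 ≤ b ∨ b = n (q + 1)) ∧
      (∑ i ∈ Finset.Ico a (a + b), p (q + 1) i) * ν.real (piece n c q L) ≤
        ν.real (Metric.ball x r) := by
  refine ⟨i₀ - l, min (n (q + 1)) (i₀ + l + 1) - (i₀ - l), by omega, by omega, by omega,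
    by omega, ?_⟩
  refine h.sum_le hL (fun i hi => ?_) fun i hi u hu => ?_
  · rw [Finset.mem_Ico] at hi
    omega
  · rw [Finset.mem_Ico] at hi
    have h1 := h.data.mul_period_le q (show i ≤ i₀ + l by omega)
    have h2 := h.data.mul_period_le q (show i₀ ≤ i + l by omega)
    push_cast at h1 h2
    rw [Metric.mem_ball, Real.dist_eq, abs_lt]
    constructor <;> linarith [hu.1, hu.2, hx.1, hx.2]

/-! ### The scale of a ball and the three components met by a half ball. -/

theorem IsCantorData.exists_level (h : IsCantorData n c) {r : ℝ} (hr : 0 < r) (hr1 : r ≤ 1) :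
    ∃ q, compLen n c (q + 1) < r ∧ r ≤ compLen n c q := by
  classical
  have hex : ∃ q, compLen n c q < r := by
    obtain ⟨q, hq⟩ := exists_pow_lt_of_lt_one hr (by norm_num : (1 / 2 : ℝ) < 1)
    exact ⟨q, (h.compLen_le_pow q).trans_lt hq⟩
  have h0 : Nat.find hex ≠ 0 := fun h0 => by
    have := Nat.find_spec hex
    rw [h0, compLen_zero] at this
    linarith
  refine ⟨Nat.find hex - 1, ?_, not_lt.1 (Nat.find_min hex (by omega))⟩
  rw [Nat.sub_add_cancel (by omega)]
  exact Nat.find_spec hex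

theorem IsCantorData.exists_count (h : IsCantorData n c) (q : ℕ) {r : ℝ}
    (hr : compLen n c (q + 1) < r) : ∃ l : ℕ, l * period n c q + compLen n c (q + 1) < r ∧
      r ≤ (l + 1) * period n c q + compLen n c (q + 1) := by
  classical
  have hp := h.period_pos q
  have hex : ∃ l : ℕ, r ≤ (l + 1) * period n c q + compLen n c (q + 1) := by
    obtain ⟨l, hl⟩ := exists_nat_gt (r / period n c q)
    rw [div_lt_iff₀ hp] at hl
    exact ⟨l, by linarith [h.compLen_pos (q + 1)]⟩
  refine ⟨Nat.find hex, ?_, Nat.find_spec hex⟩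
  rcases Nat.eq_zero_or_pos (Nat.find hex) with h0 | h0
  · rw [h0]
    simpa using hr
  · have := not_le.1 (Nat.find_min hex (m := Nat.find hex - 1) (by omega))
    rw [Nat.cast_sub h0] at this
    push_cast at this
    linarith

theorem IsWeighted.entry_nonneg (h : IsWeighted n c p ν) (q : ℕ) :
    ∀ i < n (q + 1), 0 ≤ p (q + 1) i := fun i hi => (h.pos q i hi).le

/-- Since 2r is at most (2l + 2) periods plus 2 δ_{q+1}, the double ball reaches at most 2l + 4
children away from i₀. The block inside the ball has length b ≥ l + 1 or is everything, so four
rounds of enlargement suffice. -/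
theorem IsWeighted.own_le (h : IsWeighted n c p ν) (U : UniformWeights n c p C)
    (hC : 1 ≤ C) {q : ℕ} {L x r : ℝ} (hL : L ∈ leftSet n c q) {i₀ l a b : ℕ}
    (hx : x ∈ piece n c (q + 1) (L + i₀ * period n c q))
    (hr : r ≤ (l + 1) * period n c q + compLen n c (q + 1))
    (hab : a + b ≤ n (q + 1)) (ha : a ≤ i₀) (hb : i₀ < a + b) (hl : l + 1 ≤ b ∨ b = n (q + 1)) :
    ν.real (Metric.ball x (2 * r) ∩ piece n c q L) ≤
      ((1 + 2 * C) ^ 4 * ∑ i ∈ Finset.Ico a (a + b), p (q + 1) i) * ν.real (piece n c q L) := by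
  have hp : period n c q = compLen n c (q + 1) + gapLen n c (q + 1) := rfl
  have hp0 := h.data.period_pos q
  have hg := h.data.gapLen_pos q
  have hmem : ∀ i ∈ (Finset.range (n (q + 1))).filter
      (fun i => i ≤ i₀ + (2 * l + 4) ∧ i₀ ≤ i + (2 * l + 4)), i < n (q + 1) ∧
        i ≤ i₀ + (2 * l + 4) ∧ i₀ ≤ i + (2 * l + 4) := by
    intro i hi
    simpa using hi
  refine (h.le_sum hL (F := (Finset.range (n (q + 1))).filter
    (fun i => i ≤ i₀ + (2 * l + 4) ∧ i₀ ≤ i + (2 * l + 4))) (fun i hi => (hmem i hi).1)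
    ?_).trans ?_
  · rintro u hu ⟨hur, huL⟩
    obtain ⟨i, hi, hui⟩ := h.data.exists_mem_child hL hu huL
    rw [Metric.mem_ball, Real.dist_eq, abs_lt] at hur
    refine ⟨i, ?_, hui⟩
    rw [Finset.mem_filter, Finset.mem_range]
    refine ⟨hi, ?_, ?_⟩
    · by_contra hlt
      have := h.data.succ_mul_period_le q (not_le.1 hlt)
      push_cast at this
      linarith [hui.1, hx.2]
    · by_contra hlt
      have := h.data.succ_mul_period_le q (not_le.1 hlt)
      push_cast at this
      linarith [hui.2, hx.1]
  · refine mul_le_mul_of_nonneg_right ?_ measureReal_nonneg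
    refine (U.single q).le_mul (by linarith) (h.entry_nonneg q) 4 (by omega) hab fun i hi => ?_
    have := hmem i hi
    omega

/-- When 2r exceeds δ_q, the parent has at most 2l + 4 children, and four enlargements of the block
exhaust it. The block then carries a fixed share of the parent's mass. -/
theorem IsWeighted.whole_le (h : IsWeighted n c p ν) (U : UniformWeights n c p C)
    (hC : 1 ≤ C) {q : ℕ} {r : ℝ} {l a b : ℕ}
    (hr : r ≤ (l + 1) * period n c q + compLen n c (q + 1))
    (hab : a + b ≤ n (q + 1)) (hb : 1 ≤ b) (hl : l + 1 ≤ b ∨ b = n (q + 1))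
    (hδ : compLen n c q < 2 * r) :
    1 ≤ (1 + 2 * C) ^ 4 * ∑ i ∈ Finset.Ico a (a + b), p (q + 1) i := by
  have hp : period n c q = compLen n c (q + 1) + gapLen n c (q + 1) := rfl
  have hp0 := h.data.period_pos q
  have hg := h.data.gapLen_pos q
  have hlen := h.data.compLen_eq q
  have hn : n (q + 1) ≤ 2 * l + 4 := by
    by_contra hlt
    have := h.data.succ_mul_period_le q (not_le.1 hlt)
    push_cast at this
    linarith [h.data.compLen_pos (q + 1)]
  refine (h.sum_eq q).ge.trans ?_
  refine (U.single q).le_mul (by linarith) (h.entry_nonneg q) 4 hb hab fun i hi => ?_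
  rw [Finset.mem_range] at hi
  omega

theorem sum_repeatSeq_left {m : ℕ} (f : ℕ → ℝ) {a b : ℕ} (hb : b ≤ m) :
    ∑ i ∈ Finset.Ico a b, repeatSeq m f i = ∑ i ∈ Finset.Ico a b, f i :=
  Finset.sum_congr rfl fun i hi => by
    rw [Finset.mem_Ico] at hi
    rw [repeatSeq, if_pos (by omega)]

theorem sum_repeatSeq_right {m : ℕ} (f : ℕ → ℝ) (F : Finset ℕ) :
    ∑ i ∈ F.map (addLeftEmbedding m), repeatSeq m f i = ∑ i ∈ F, f i := by
  rw [Finset.sum_map]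
  refine Finset.sum_congr rfl fun i _ => ?_
  rw [addLeftEmbedding_apply, repeatSeq, if_neg (by omega)]
  congr 1
  omega

theorem IsWeighted.repeatSeq_nonneg (h : IsWeighted n c p ν) (q : ℕ) :
    ∀ i < n (q + 1) + n (q + 1), 0 ≤ repeatSeq (n (q + 1)) (p (q + 1)) i := by
  intro i hi
  rw [repeatSeq]
  split_ifs
  · exact h.entry_nonneg q _ (by omega)
  · exact h.entry_nonneg q _ (by omega)

/-- The vector `(P_{q+1}, P_{q+1})` is uniform from some length on which is at most the length
seen by the ball. -/
theorem UniformWeights.repeat_uniform (U : UniformWeights n c p C) (hd : IsCantorData n c)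
    {k q l : ℕ} (hk : k ∈ Lam n c) (hkq : k ≤ q) (hgap : gapLen n c k < compLen n c q)
    (hl : gapLen n c k < (2 * l + 4) * period n c q) :
    ∃ s, 1 ≤ s ∧ s ≤ n (q + 1) ∧ s ≤ 4 * (l + 1) ∧
      BlockDoubling C s (n (q + 1) + n (q + 1)) (repeatSeq (n (q + 1)) (p (q + 1))) := by
  have hqm := hd.lt_add_mIdx hk hgap
  have h2 := hd.two_le (q + 1) (by omega)
  rcases Nat.lt_or_ge (q + 1) (k + mIdx n c k) with hlt | hge
  · have := U.inner k hk (q + 1 - k) (by omega) (by omega)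
    rw [show k + (q + 1 - k) = q + 1 by omega] at this
    exact ⟨1, le_rfl, by omega, by omega, this⟩
  · have heq : k + mIdx n c k = q + 1 := by omega
    have hB := U.last k hk
    obtain ⟨hs1, hs2, -⟩ := sIdx_mem hd hk
    rw [heq] at hB hs2
    have hp : period n c q = compLen n c (q + 1) + gapLen n c (q + 1) := rfl
    have hp0 := hd.period_pos q
    have hδ := hd.compLen_pos (q + 1)
    have hs2' : (sIdx n c k : ℝ) * period n c q ≤ gapLen n c k + gapLen n c (q + 1) := by
      rw [hp]
      linarith
    have hg := hd.gapLen_pos q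
    have hlen := hd.compLen_eq q
    refine ⟨sIdx n c k, hs1, ?_, ?_, hB⟩
    -- s_k periods fit into ε_k + ε_{q+1}, which is less than δ_q + ε_{q+1}, that is, n_{q+1}
    -- periods. The next bound compares them with 2l + 5 periods in the same way.
    · by_contra hlt
      have := hd.succ_mul_period_le q (not_le.1 hlt)
      linarith
    · by_contra hlt
      have := hd.succ_mul_period_le q (show 2 * l + 4 < sIdx n c k by omega)
      push_cast at this
      linarith

/-- If 2r > δ_q, the block is comparable to its whole parent and `IsWeighted.gap_ratio` finishes.
Otherwise the block is compared inside (P, P) with the part of the second copy that the ball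
reaches. The exponent 8 is 4 for lengthening the block to the admissible length s and 4 for crossing
the junction. -/
theorem IsWeighted.next_le (h : IsWeighted n c p ν) (U : UniformWeights n c p C)
    (hC : 1 ≤ C) {M : ℕ} (hM : ∀ k ∈ Lam n c, mIdx n c k ≤ M) {q : ℕ} {L x r : ℝ} {j : ℕ}
    (hj : j + 1 ≤ q) (hz : IsGap n c j (L + compLen n c q)) {i₀ l a b : ℕ}
    (hx : x ∈ piece n c (q + 1) (L + i₀ * period n c q)) (hxL : x ∈ piece n c q L)
    (hrq : r ≤ compLen n c q)
    (hr : r ≤ (l + 1) * period n c q + compLen n c (q + 1))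
    (hab : a + b ≤ n (q + 1)) (ha : a ≤ i₀) (hb : i₀ < a + b) (hl : l + 1 ≤ b ∨ b = n (q + 1)) :
    ν.real (Metric.ball x (2 * r) ∩
        piece n c q (L + compLen n c q + gapLen n c (j + 1))) ≤
      ((1 + 2 * C) ^ 8 * ∑ i ∈ Finset.Ico a (a + b), p (q + 1) i) *
        (C ^ (M + 1) * ν.real (piece n c q L)) := by
  have hsum : 0 ≤ ∑ i ∈ Finset.Ico a (a + b), p (q + 1) i :=
    Finset.sum_nonneg fun i hi => h.entry_nonneg q i (by rw [Finset.mem_Ico] at hi; omega)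
  by_cases hfar : 2 * r ≤ gapLen n c (j + 1)
  · calc _ ≤ ν.real ∅ := h.mono fun u _ hu => by
          obtain ⟨hur, hu1, -⟩ := hu
          rw [Metric.mem_ball, Real.dist_eq, abs_lt] at hur
          linarith [hxL.2]
      _ = 0 := measureReal_empty
      _ ≤ _ := by positivity
  push Not at hfar
  have hratio := h.gap_ratio U hC hM hz hj (q := q) (by linarith)
  rw [add_sub_cancel_right] at hratio
  by_cases hbig : compLen n c q < 2 * r
  · have hw := h.whole_le U hC hr hab (by omega) hl hbig
    have hpow : (1 : ℝ) ≤ (1 + 2 * C) ^ 4 := one_le_pow₀ (by linarith)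
    have hw' : 1 ≤ (1 + 2 * C) ^ 8 * ∑ i ∈ Finset.Ico a (a + b), p (q + 1) i := by
      have : (1 + 2 * C) ^ 8 = (1 + 2 * C) ^ 4 * (1 + 2 * C) ^ 4 := by ring
      rw [this, mul_assoc]
      nlinarith
    calc _ ≤ ν.real (piece n c q (L + compLen n c q + gapLen n c (j + 1))) :=
          h.mono fun u _ hu => hu.2
      _ ≤ C ^ (M + 1) * ν.real (piece n c q L) := hratio
      _ ≤ _ := le_mul_of_one_le_left (by positivity) hw'
  push Not at hbig
  have hp : period n c q = compLen n c (q + 1) + gapLen n c (q + 1) := rfl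
  have hp0 := h.data.period_pos q
  have hg := h.data.gapLen_pos q
  have hg' := h.data.gapLen_pos j
  have hlen := h.data.compLen_eq q
  have hr2 : 2 * r ≤ (2 * l + 4) * period n c q := by linarith
  -- Here ε_{j+1} < 2r ≤ δ_q ≤ δ_{j+1}.
  have hk : j + 1 ∈ Lam n c :=
    ⟨by omega, by linarith [h.data.compLen_strictAnti.antitone hj]⟩
  obtain ⟨s, hs1, hsn, hsl, hB⟩ := U.repeat_uniform h.data (l := l) hk hj (by linarith)
    (by linarith)
  -- The block is lengthened to at least s components, pushed left if it would overrun the parent.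
  -- Since s ≤ 4(l + 1) and s ≤ n_{q+1}, it stays within 4b of the old block.
  obtain ⟨a', b', hab', hsb', hbb', ha', hend⟩ : ∃ a' b', a' + b' ≤ n (q + 1) ∧ s ≤ b' ∧ b ≤ b' ∧
      a' ≤ a ∧ a + b ≤ a' + b' ∧ a ≤ a' + 4 * b ∧ a' + b' ≤ a + b + 4 * b := by
    rcases Nat.lt_or_ge b s with hlt | hge
    · exact ⟨min a (n (q + 1) - s), s, by omega, by omega, by omega, by omega, by omega,
        by omega, by omega⟩
    · exact ⟨a, b, by omega, by omega, by omega, by omega, by omega, by omega, by omega⟩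
  have hgrow : ∑ i ∈ Finset.Ico a' (a' + b'), p (q + 1) i ≤
      (1 + 2 * C) ^ 4 * ∑ i ∈ Finset.Ico a (a + b), p (q + 1) i := by
    refine (U.single q).le_mul (by linarith) (h.entry_nonneg q) 4 (by omega) hab fun i hi => ?_
    rw [Finset.mem_Ico] at hi
    omega
  have hmem : ∀ i ∈ (Finset.range (n (q + 1))).filter
      (fun i => n (q + 1) + i ≤ i₀ + (2 * l + 4)), i < n (q + 1) ∧
        n (q + 1) + i ≤ i₀ + (2 * l + 4) := by
    intro i hi
    simpa using hi
  -- Child i of the next component sits at position n_{q+1} + i of (P, P). The gap itself only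
  -- shortens the reach of the ball and is ignored in this count.
  have hcross : ∑ i ∈ (Finset.range (n (q + 1))).filter
      (fun i => n (q + 1) + i ≤ i₀ + (2 * l + 4)), p (q + 1) i ≤
      (1 + 2 * C) ^ 4 * ∑ i ∈ Finset.Ico a' (a' + b'), p (q + 1) i := by
    rw [← sum_repeatSeq_left _ hab', ← sum_repeatSeq_right]
    refine hB.le_mul (by linarith) (h.repeatSeq_nonneg q) 4 hsb' (by omega) fun i hi => ?_
    rw [Finset.mem_map] at hi
    obtain ⟨i, hi, rfl⟩ := hi
    have := hmem i hi
    rw [addLeftEmbedding_apply]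
    omega
  refine (h.le_sum (h.data.gap_right_mem hz hj) (F := (Finset.range (n (q + 1))).filter
    (fun i => n (q + 1) + i ≤ i₀ + (2 * l + 4))) (fun i hi => (hmem i hi).1) ?_).trans ?_
  · rintro u hu ⟨hur, huL⟩
    obtain ⟨i, hi, hui⟩ := h.data.exists_mem_child (h.data.gap_right_mem hz hj) hu huL
    rw [Metric.mem_ball, Real.dist_eq, abs_lt] at hur
    refine ⟨i, ?_, hui⟩
    rw [Finset.mem_filter, Finset.mem_range]
    refine ⟨hi, ?_⟩
    by_contra hlt
    have := h.data.succ_mul_period_le q (not_le.1 hlt)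
    push_cast at this
    linarith [hui.1, hx.2]
  · refine mul_le_mul (hcross.trans ?_) hratio measureReal_nonneg (by positivity)
    calc _ ≤ (1 + 2 * C) ^ 4 *
          ((1 + 2 * C) ^ 4 * ∑ i ∈ Finset.Ico a (a + b), p (q + 1) i) :=
          mul_le_mul_of_nonneg_left hgrow (by positivity)
      _ = _ := by ring

/-- A ball that reaches the second neighbour crosses a whole component, so 2r > δ_q and both gaps
are shorter than 2 δ_q. Hence `IsWeighted.whole_le` applies, with one factor C^(M+1) per gap. -/
theorem IsWeighted.second_le (h : IsWeighted n c p ν) (U : UniformWeights n c p C)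
    (hC : 1 ≤ C) {M : ℕ} (hM : ∀ k ∈ Lam n c, mIdx n c k ≤ M) {q : ℕ} {L x r : ℝ} {j j' : ℕ}
    (hj : j + 1 ≤ q) (hz : IsGap n c j (L + compLen n c q)) (hj' : j' + 1 ≤ q)
    (hz' : IsGap n c j' (L + compLen n c q + gapLen n c (j + 1) + compLen n c q))
    {l a b : ℕ} (hxL : x ∈ piece n c q L) (hrq : r ≤ compLen n c q)
    (hr : r ≤ (l + 1) * period n c q + compLen n c (q + 1))
    (hab : a + b ≤ n (q + 1)) (hb : 1 ≤ b) (hl : l + 1 ≤ b ∨ b = n (q + 1)) :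
    ν.real (Metric.ball x (2 * r) ∩ piece n c q
        (L + compLen n c q + gapLen n c (j + 1) + compLen n c q + gapLen n c (j' + 1))) ≤
      ((1 + 2 * C) ^ 4 * ∑ i ∈ Finset.Ico a (a + b), p (q + 1) i) *
        (C ^ (M + 1) * (C ^ (M + 1) * ν.real (piece n c q L))) := by
  have hsum : 0 ≤ ∑ i ∈ Finset.Ico a (a + b), p (q + 1) i :=
    Finset.sum_nonneg fun i hi => h.entry_nonneg q i (by rw [Finset.mem_Ico] at hi; omega)
  have hg := h.data.gapLen_pos j
  have hg' := h.data.gapLen_pos j'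
  have hδ := h.data.compLen_pos q
  by_cases hfar : 2 * r ≤ gapLen n c (j + 1) + compLen n c q + gapLen n c (j' + 1)
  · calc _ ≤ ν.real ∅ := h.mono fun u _ hu => by
          obtain ⟨hur, hu1, -⟩ := hu
          rw [Metric.mem_ball, Real.dist_eq, abs_lt] at hur
          linarith [hxL.2]
      _ = 0 := measureReal_empty
      _ ≤ _ := by positivity
  push Not at hfar
  have hratio := h.gap_ratio U hC hM hz hj (q := q) (by linarith)
  rw [add_sub_cancel_right] at hratio
  have hratio' := h.gap_ratio U hC hM hz' hj' (q := q) (by linarith)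
  rw [add_sub_cancel_right] at hratio'
  have hw := h.whole_le U hC hr hab hb hl (by linarith)
  calc _ ≤ ν.real (piece n c q (L + compLen n c q + gapLen n c (j + 1) + compLen n c q +
          gapLen n c (j' + 1))) := h.mono fun u _ hu => hu.2
    _ ≤ C ^ (M + 1) * (C ^ (M + 1) * ν.real (piece n c q L)) :=
        hratio'.trans (mul_le_mul_of_nonneg_left hratio (by positivity))
    _ ≤ _ := le_mul_of_one_le_left (by positivity) hw

theorem IsWeighted.right_half_le (h : IsWeighted n c p ν) (U : UniformWeights n c p C)
    (hC : 1 ≤ C) {M : ℕ} (hM : ∀ k ∈ Lam n c, mIdx n c k ≤ M) {x r : ℝ}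
    (hx : x ∈ cantorSet n c) (hr : 0 < r) :
    ν.real (Metric.ball x (2 * r) ∩ Ici x) ≤
      (3 * (1 + 2 * C) ^ 8 * (C ^ (M + 1)) ^ 2) * ν.real (Metric.ball x r) := by
  have hprob := h.prob
  have hQ : (1 : ℝ) ≤ (1 + 2 * C) ^ 4 := one_le_pow₀ (by linarith)
  have hR : (1 : ℝ) ≤ C ^ (M + 1) := one_le_pow₀ hC
  have hK : (1 : ℝ) ≤ (1 + 2 * C) ^ 8 * (C ^ (M + 1)) ^ 2 :=
    one_le_mul_of_one_le_of_one_le (one_le_pow₀ (by linarith)) (one_le_pow₀ hR)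
  by_cases hr1 : 1 < r
  · calc ν.real (Metric.ball x (2 * r) ∩ Ici x) ≤ ν.real (Metric.ball x r) :=
          h.mono fun u hu _ => by
            have h1 := cantorSet_subset hu
            have h2 := cantorSet_subset hx
            rw [Metric.mem_ball, Real.dist_eq, abs_lt]
            constructor <;> linarith
      _ ≤ _ := le_mul_of_one_le_left measureReal_nonneg (by linarith)
  obtain ⟨q, hq1, hq2⟩ := h.data.exists_level hr (not_lt.1 hr1)
  obtain ⟨L, hL, hxL⟩ := exists_mem_piece hx q
  obtain ⟨i₀, hi₀, hxi⟩ := h.data.exists_mem_child hL hx hxL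
  obtain ⟨l, hl1, hl2⟩ := h.data.exists_count q hq1
  obtain ⟨a, b, hab, ha, hb, hbl, hblock⟩ := h.exists_block hL hi₀ hxi hl1
  have hδ := h.data.compLen_pos q
  have T1 := h.own_le U hC hL hxi hl2 hab ha hb hbl
  set Y := ∑ i ∈ Finset.Ico a (a + b), p (q + 1) i with hY
  set m := ν.real (piece n c q L) with hm
  have hY0 : 0 ≤ Y :=
    Finset.sum_nonneg fun i hi => h.entry_nonneg q i (by rw [Finset.mem_Ico] at hi; omega)
  have hm0 : 0 ≤ m := measureReal_nonneg
  set Q := (1 + 2 * C) ^ 4 with hQdef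
  set R := C ^ (M + 1) with hRdef
  have hQ8 : (1 + 2 * C) ^ 8 = Q * Q := by rw [hQdef]; ring
  rw [hQ8]
  have hQQ : Q ≤ Q * Q := by nlinarith
  have hRR : R ≤ R ^ 2 := by nlinarith
  have hYm : 0 ≤ Y * m := mul_nonneg hY0 hm0
  have B1 : Q * Y * m ≤ Q * Q * R ^ 2 * (Y * m) := by
    rw [mul_assoc]
    exact mul_le_mul_of_nonneg_right (by nlinarith) hYm
  have B2 : Q * Q * Y * (R * m) ≤ Q * Q * R ^ 2 * (Y * m) := by
    have : Q * Q * Y * (R * m) = Q * Q * R * (Y * m) := by ring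
    rw [this]
    exact mul_le_mul_of_nonneg_right (mul_le_mul_of_nonneg_left hRR (by nlinarith)) hYm
  have B3 : Q * Y * (R * (R * m)) ≤ Q * Q * R ^ 2 * (Y * m) := by
    have : Q * Y * (R * (R * m)) = Q * R ^ 2 * (Y * m) := by ring
    rw [this]
    exact mul_le_mul_of_nonneg_right (mul_le_mul_of_nonneg_right hQQ (by positivity)) hYm
  have hKm : Q * Q * R ^ 2 * (Y * m) ≤ Q * Q * R ^ 2 * ν.real (Metric.ball x r) :=
    mul_le_mul_of_nonneg_left hblock (by positivity)
  have hK0 : 0 ≤ Q * Q * R ^ 2 * (Y * m) := by positivity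
  rcases h.data.last_or_gap hL with hlast | ⟨j, hj, hz⟩
  · have : ν.real (Metric.ball x (2 * r) ∩ Ici x) ≤
        ν.real (Metric.ball x (2 * r) ∩ piece n c q L) :=
      h.mono fun u hu hS => ⟨hS.1, hxL.1.trans hS.2, hlast u hu⟩
    linarith
  have hg := h.data.gapLen_pos j
  have T2 := h.next_le U hC hM hj hz hxi hxL hq2 hl2 hab ha hb hbl
  rw [hQ8, ← hY, ← hm] at T2
  have hmemL : ∀ u ∈ cantorSet n c, u ∈ Metric.ball x (2 * r) ∩ Ici x →
      u ∈ piece n c q L ∨ L + compLen n c q + gapLen n c (j + 1) ≤ u := fun u hu hS =>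
    (h.data.gap_empty hz hu).imp (fun h1 => ⟨hxL.1.trans hS.2, h1⟩) id
  rcases h.data.last_or_gap (h.data.gap_right_mem hz hj) with hlast | ⟨j', hj', hz'⟩
  · have : ν.real (Metric.ball x (2 * r) ∩ Ici x) ≤
        ν.real (Metric.ball x (2 * r) ∩ piece n c q L ∪ Metric.ball x (2 * r) ∩
          piece n c q (L + compLen n c q + gapLen n c (j + 1))) :=
      h.mono fun u hu hS => (hmemL u hu hS).imp (fun h1 => ⟨hS.1, h1⟩)
        (fun h1 => ⟨hS.1, h1, hlast u hu⟩)
    have h2 := measureReal_union_le (μ := ν) (Metric.ball x (2 * r) ∩ piece n c q L)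
      (Metric.ball x (2 * r) ∩ piece n c q (L + compLen n c q + gapLen n c (j + 1)))
    linarith
  · have hg' := h.data.gapLen_pos j'
    have T3 := h.second_le U hC hM hj hz hj' hz' hxL hq2 hl2 hab (by omega) hbl
    rw [← hY, ← hm] at T3
    have : ν.real (Metric.ball x (2 * r) ∩ Ici x) ≤
        ν.real ((Metric.ball x (2 * r) ∩ piece n c q L ∪ Metric.ball x (2 * r) ∩
          piece n c q (L + compLen n c q + gapLen n c (j + 1))) ∪ Metric.ball x (2 * r) ∩
          piece n c q (L + compLen n c q + gapLen n c (j + 1) + compLen n c q +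
            gapLen n c (j' + 1))) := by
      refine h.mono fun u hu hS => ?_
      rcases hmemL u hu hS with h1 | h1
      · exact Or.inl (Or.inl ⟨hS.1, h1⟩)
      · rcases h.data.gap_empty hz' hu with h2 | h2
        · exact Or.inl (Or.inr ⟨hS.1, h1, h2⟩)
        -- As 2r ≤ 2 δ_q, the ball cannot pass the right end of the second neighbour.
        · refine Or.inr ⟨hS.1, h2, ?_⟩
          have := hS.1
          rw [Metric.mem_ball, Real.dist_eq, abs_lt] at this
          linarith [hxL.2]
    have h2 := measureReal_union_le (μ := ν) (Metric.ball x (2 * r) ∩ piece n c q L)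
      (Metric.ball x (2 * r) ∩ piece n c q (L + compLen n c q + gapLen n c (j + 1)))
    have h3 := measureReal_union_le (μ := ν) (Metric.ball x (2 * r) ∩ piece n c q L ∪
        Metric.ball x (2 * r) ∩ piece n c q (L + compLen n c q + gapLen n c (j + 1)))
      (Metric.ball x (2 * r) ∩ piece n c q (L + compLen n c q + gapLen n c (j + 1) +
        compLen n c q + gapLen n c (j' + 1)))
    linarith

theorem map_reflect_real_set (ν : Measure ℝ) {S : Set ℝ} (hS : MeasurableSet S) :
    (ν.map fun x => 1 - x).real S = ν.real ((fun x => 1 - x) ⁻¹' S) :=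
  map_measureReal_apply (by fun_prop) hS

theorem reflect_preimage_ball (x r : ℝ) :
    (fun u : ℝ => 1 - u) ⁻¹' Metric.ball (1 - x) r = Metric.ball x r := by
  ext u
  rw [mem_preimage, Metric.mem_ball, Metric.mem_ball, Real.dist_eq, Real.dist_eq,
    ← abs_neg (u - x)]
  ring_nf

/-- The left half is the right half for the reflected measure, whose reversed weights are uniform
with the same constant. -/
theorem IsWeighted.ball_le (h : IsWeighted n c p ν) (U : UniformWeights n c p C)
    (hC : 1 ≤ C) {M : ℕ} (hM : ∀ k ∈ Lam n c, mIdx n c k ≤ M) {x r : ℝ}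
    (hx : x ∈ cantorSet n c) (hr : 0 < r) :
    ν.real (Metric.ball x (2 * r)) ≤
      (2 * (3 * (1 + 2 * C) ^ 8 * (C ^ (M + 1)) ^ 2)) * ν.real (Metric.ball x r) := by
  have hprob := h.prob
  have h1 := h.right_half_le U hC hM hx hr
  have h2 := h.reflect.right_half_le U.reflect hC hM (h.data.reflect_mem hx) hr
  rw [map_reflect_real_set _ (Metric.isOpen_ball.measurableSet.inter measurableSet_Ici),
    map_reflect_real_set _ Metric.isOpen_ball.measurableSet, preimage_inter,
    reflect_preimage_ball, reflect_preimage_ball] at h2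
  have h3 : ν.real (Metric.ball x (2 * r)) ≤ ν.real ((Metric.ball x (2 * r) ∩ Ici x) ∪
      (Metric.ball x (2 * r) ∩ (fun u => 1 - u) ⁻¹' Ici (1 - x))) := by
    refine h.mono fun u _ hu => ?_
    rcases le_total x u with hxu | hxu
    · exact Or.inl ⟨hu, hxu⟩
    · exact Or.inr ⟨hu, sub_le_sub_left hxu 1⟩
  have h4 := measureReal_union_le (μ := ν) (Metric.ball x (2 * r) ∩ Ici x)
    (Metric.ball x (2 * r) ∩ (fun u => 1 - u) ⁻¹' Ici (1 - x))
  linarith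

end Sufficiency

/-! ### A doubling measure has uniform weights -/

/-- `ν` is doubling with constant `D` at the points of the Cantor set. -/
def DoublingOn (n : ℕ → ℕ) (c : ℕ → ℝ) (ν : Measure ℝ) (D : ℝ) : Prop :=
  ∀ x ∈ cantorSet n c, ∀ r, 0 < r →
    ν.real (Metric.ball x (2 * r)) ≤ D * ν.real (Metric.ball x r)

/-- The constant for the comparison of two neighbouring components `d` levels above the level whose
components are shorter than the gap between them. -/
def gapConst (D : ℝ) : ℕ → ℝ
  | 0 => D ^ 3
  | d + 1 => D ^ 4 * (1 + gapConst D d)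

theorem one_le_gapConst {D : ℝ} (hD : 1 ≤ D) (d : ℕ) : 1 ≤ gapConst D d := by
  induction d with
  | zero => exact one_le_pow₀ hD
  | succ d ih =>
    have := one_le_pow₀ (n := 4) hD
    rw [gapConst]
    nlinarith

theorem gapConst_mono {D : ℝ} (hD : 1 ≤ D) : Monotone (gapConst D) :=
  monotone_nat_of_le_succ fun d => by
    have := one_le_pow₀ (n := 4) hD
    have := one_le_gapConst hD d
    rw [gapConst]
    nlinarith

section Necessity

variable {n : ℕ → ℕ} {c : ℕ → ℝ} {p : ℕ → ℕ → ℝ} {ν : Measure ℝ} {D : ℝ}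

theorem DoublingOn.iterate (hd : DoublingOn n c ν D) (hD : 1 ≤ D) {x : ℝ}
    (hx : x ∈ cantorSet n c) {r : ℝ} (hr : 0 < r) (N : ℕ) :
    ν.real (Metric.ball x (2 ^ N * r)) ≤ D ^ N * ν.real (Metric.ball x r) := by
  induction N with
  | zero => simp
  | succ N ih =>
    have := hd x hx (2 ^ N * r) (by positivity)
    rw [pow_succ', mul_assoc, pow_succ', mul_assoc]
    exact this.trans (mul_le_mul_of_nonneg_left ih (by linarith))

theorem DoublingOn.le_of_subset (hd : DoublingOn n c ν D) (h : IsWeighted n c p ν) (hD : 1 ≤ D)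
    {x : ℝ} (hx : x ∈ cantorSet n c) {r : ℝ} (hr : 0 < r) (N : ℕ) {S : Set ℝ}
    (hS : ∀ u ∈ S, x - 2 ^ N * r < u ∧ u < x + 2 ^ N * r) :
    ν.real S ≤ D ^ N * ν.real (Metric.ball x r) :=
  (h.mono fun u _ hu => by
    have := hS u hu
    rw [Metric.mem_ball, Real.dist_eq, abs_lt]
    constructor <;> linarith).trans (hd.iterate hD hx hr N)

theorem DoublingOn.reflect (hd : DoublingOn n c ν D) (h : IsWeighted n c p ν) :
    DoublingOn n c (ν.map fun x => 1 - x) D := by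
  intro x hx r hr
  have := hd (1 - x) (h.data.reflect_mem hx) r hr
  rw [map_reflect_real_set _ Metric.isOpen_ball.measurableSet,
    map_reflect_real_set _ Metric.isOpen_ball.measurableSet]
  have e : ∀ s, (fun u : ℝ => 1 - u) ⁻¹' Metric.ball x s = Metric.ball (1 - x) s := fun s => by
    rw [← reflect_preimage_ball (1 - x) s, sub_sub_cancel]
  rwa [e, e]

/-- A block of at least three components contains a ball of comparable size. -/
theorem IsWeighted.exists_ball_le_block (h : IsWeighted n c p ν) {q : ℕ} {L : ℝ}
    (hL : L ∈ leftSet n c q) {a l : ℕ} (hal : a + l ≤ n (q + 1)) (hl : 3 ≤ l) :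
    ∃ x ∈ cantorSet n c, L + a * period n c q ≤ x ∧ x ≤ L + (a + l) * period n c q ∧
      ν.real (Metric.ball x (l * period n c q / 4)) ≤
        (∑ i ∈ Finset.Ico a (a + l), p (q + 1) i) * ν.real (piece n c q L) := by
  have hp : period n c q = compLen n c (q + 1) + gapLen n c (q + 1) := rfl
  have hp0 := h.data.period_pos q
  have hg := h.data.gapLen_pos q
  have hδ := h.data.compLen_pos (q + 1)
  have hlen := h.data.compLen_eq q
  have c1 : ((l : ℕ) : ℝ) * period n c q ≤ 4 * ((l / 2 : ℕ) * period n c q) := by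
    rw [← mul_assoc]
    exact mul_le_mul_of_nonneg_right (by exact_mod_cast (by omega : l ≤ 4 * (l / 2))) hp0.le
  -- The centre is the left end of the middle child, number a + ⌊l/2⌋. The inequality 4⌊l/2⌋ + 4 ≤
  -- 3l, which keeps the ball inside the block on the right, uses l ≥ 3.
  have c2 : 4 * ((l / 2 : ℕ) * period n c q) + 4 * period n c q ≤ 3 * (l * period n c q) := by
    have : (4 : ℝ) * (l / 2 : ℕ) + 4 ≤ 3 * l := by
      exact_mod_cast (by omega : 4 * (l / 2) + 4 ≤ 3 * l)
    nlinarith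
  have c3 := h.data.mul_period_le q hal
  have c4 : 0 ≤ (a : ℝ) * period n c q := by positivity
  push_cast at c3
  have hx := child_mem_leftSet hL (i := a + l / 2) (by omega)
  refine ⟨_, h.data.left_mem_cantorSet hx, ?_, ?_, ?_⟩
  · exact add_le_add_right (h.data.mul_period_le q (by omega)) _
  · have := h.data.mul_period_le q (show a + l / 2 ≤ a + l by omega)
    push_cast at this ⊢
    linarith
  · refine h.le_sum hL (fun i hi => ?_) fun u hu hur => ?_
    · rw [Finset.mem_Ico] at hi
      omega
    · rw [Metric.mem_ball, Real.dist_eq, abs_lt] at hur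
      push_cast at hur
      obtain ⟨i, hi, hui⟩ := h.data.exists_mem_child hL hu ⟨by linarith, by linarith⟩
      refine ⟨i, ?_, hui⟩
      rw [Finset.mem_Ico]
      constructor
      · by_contra hlt
        have := h.data.succ_mul_period_le q (not_le.1 hlt)
        linarith [hui.2]
      · by_contra hlt
        have := h.data.mul_period_le q (not_lt.1 hlt)
        push_cast at this
        linarith [hui.1]

/-! ### Doubling compares the two neighbours of a gap. -/

theorem IsCantorData.gapLen_lt (h : IsCantorData n c) {k q : ℕ} (hk : k ∈ Lam n c)
    (hq : q < k + mIdx n c k) : gapLen n c k < compLen n c q := by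
  obtain ⟨-, -, h3⟩ := mIdx_mem h hk
  exact h3.trans_le (h.compLen_strictAnti.antitone (by omega))

theorem IsCantorData.sIdx_bounds (h : IsCantorData n c) {k q : ℕ} (hk : k ∈ Lam n c)
    (hq : q + 1 = k + mIdx n c k) : 1 ≤ sIdx n c k ∧ sIdx n c k < n (q + 1) ∧
      sIdx n c k * period n c q ≤ gapLen n c k + gapLen n c (q + 1) ∧
      gapLen n c k < sIdx n c k * period n c q + compLen n c (q + 1) := by
  obtain ⟨hs1, hs2, hs3⟩ := sIdx_mem h hk
  rw [← hq] at hs2 hs3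
  have hp : period n c q = compLen n c (q + 1) + gapLen n c (q + 1) := rfl
  have h3 : sIdx n c k * period n c q ≤ gapLen n c k + gapLen n c (q + 1) := by
    rw [hp]
    linarith
  refine ⟨hs1, ?_, h3, ?_⟩
  · by_contra hlt
    have h4 := h.mul_period_le q (not_lt.1 hlt)
    have h5 := h.gapLen_lt hk (q := q) (by omega)
    have h6 := h.compLen_eq q
    linarith
  · rw [hp]
    linarith

/-- The blocks of `s_k` components at both sides of a gap of level `k`. -/
theorem DoublingOn.block_across_gap (hd : DoublingOn n c ν D) (h : IsWeighted n c p ν)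
    (hD : 1 ≤ D) {j : ℕ} {z : ℝ} (hz : IsGap n c j z) (hk : j + 1 ∈ Lam n c) {q : ℕ}
    (hq : q + 1 = j + 1 + mIdx n c (j + 1)) :
    (∑ i ∈ Finset.Ico 0 (sIdx n c (j + 1)), p (q + 1) i) *
        ν.real (piece n c q (z + gapLen n c (j + 1))) ≤
      D ^ 3 * ((∑ i ∈ Finset.Ico (n (q + 1) - sIdx n c (j + 1)) (n (q + 1)), p (q + 1) i) *
        ν.real (piece n c q (z - compLen n c q))) := by
  obtain ⟨hm1, -, -⟩ := mIdx_mem h.data hk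
  obtain ⟨hs1, hsn, hs2, hs3⟩ := h.data.sIdx_bounds hk hq
  have hjq : j + 1 ≤ q := by omega
  have hg := h.data.gapLen_pos j
  have hg' := h.data.gapLen_pos q
  have hδ := h.data.compLen_pos (q + 1)
  have hp : period n c q = compLen n c (q + 1) + gapLen n c (q + 1) := rfl
  have hp0 := h.data.period_pos q
  have hlen := h.data.compLen_eq q
  have hs1' := h.data.mul_period_le q hs1
  have hsn' := h.data.succ_mul_period_le q hsn
  push_cast at hs1'
  set s := sIdx n c (j + 1) with hs
  -- A ball of radius at most ε_k about z sees nothing to the right, and with radius at most s_k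
  -- periods it sees only the last s_k children on the left. Since ε_k ≤ 2ρ, enlarging it 8 times
  -- covers the first s_k children beyond the gap.
  set ρ := min (gapLen n c (j + 1)) (s * period n c q) with hρ
  have hρ1 : ρ ≤ gapLen n c (j + 1) := min_le_left _ _
  have hρ2 : ρ ≤ s * period n c q := min_le_right _ _
  have hρ3 : gapLen n c (j + 1) ≤ 2 * ρ := by
    rcases min_choice (gapLen n c (j + 1)) (s * period n c q) with h1 | h1 <;>
      rw [hρ, h1] <;> linarith
  have hzE := h.data.right_mem_cantorSet (h.data.gap_left_mem hz hjq)
  have hball : ν.real (Metric.ball z ρ) ≤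
      (∑ i ∈ Finset.Ico (n (q + 1) - s) (n (q + 1)), p (q + 1) i) *
        ν.real (piece n c q (z - compLen n c q)) := by
    refine h.le_sum (h.data.gap_left_mem hz hjq) (fun i hi => ?_) fun u hu hur => ?_
    · rw [Finset.mem_Ico] at hi
      omega
    · rw [Metric.mem_ball, Real.dist_eq, abs_lt] at hur
      have huz : u ≤ z := (h.data.gap_empty hz hu).resolve_right fun h1 => by linarith
      obtain ⟨i, hi, hui⟩ := h.data.exists_mem_child (h.data.gap_left_mem hz hjq) hu
        ⟨by linarith, by linarith⟩
      refine ⟨i, ?_, hui⟩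
      rw [Finset.mem_Ico]
      refine ⟨?_, hi⟩
      by_contra hlt
      have := h.data.succ_mul_period_le q (show i + s < n (q + 1) by omega)
      push_cast at this
      linarith [hui.2]
  refine le_trans ?_ (mul_le_mul_of_nonneg_left hball (by positivity))
  refine le_trans ?_ (hd.le_of_subset h hD hzE (r := ρ) (by linarith) 3
    (S := Ico z (z + 2 ^ 3 * ρ)) fun u hu => ⟨by linarith [hu.1], hu.2⟩)
  refine h.sum_le (h.data.gap_right_mem hz hjq) (fun i hi => ?_) fun i hi u hu => ?_
  · rw [Finset.mem_Ico] at hi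
    omega
  · rw [Finset.mem_Ico] at hi
    have := h.data.succ_mul_period_le q hi.2
    have h0 : 0 ≤ (i : ℝ) * period n c q := by positivity
    exact ⟨by linarith [hu.1], by linarith [hu.2]⟩

/-- The left component is to contain a ball of comparable size. This works with three or more
children; with two, the ball also sees the first child on the right, whose mass is bounded by R
times that of the last child on the left. This explains the factor 1 + R and why R matters only in
that case. -/
theorem DoublingOn.gap_step (hd : DoublingOn n c ν D) (h : IsWeighted n c p ν)
    (hD : 1 ≤ D) {j : ℕ} {z : ℝ} (hz : IsGap n c j z) {q : ℕ} (hjq : j + 1 ≤ q)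
    (hlt : gapLen n c (j + 1) < compLen n c q) {R : ℝ} (hR : 0 ≤ R)
    (hR2 : n (q + 1) = 2 → ν.real (piece n c (q + 1) (z + gapLen n c (j + 1))) ≤
      R * ν.real (piece n c (q + 1) (z - compLen n c (q + 1)))) :
    ν.real (piece n c q (z + gapLen n c (j + 1))) ≤
      D ^ 4 * (1 + R) * ν.real (piece n c q (z - compLen n c q)) := by
  have hprob := h.prob
  have h2 := h.data.two_le (q + 1) (by omega)
  have hg := h.data.gapLen_pos j
  have hg' := h.data.gapLen_pos q
  have hδ := h.data.compLen_pos (q + 1)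
  have hp : period n c q = compLen n c (q + 1) + gapLen n c (q + 1) := rfl
  have hp0 := h.data.period_pos q
  have hlen := h.data.compLen_eq q
  have hV := h.data.gap_left_mem hz hjq
  have hK := h.data.gap_right_mem hz hjq
  rcases Nat.lt_or_ge 2 (n (q + 1)) with hn | hn
  · obtain ⟨x, hx, hx1, hx2, hball⟩ := h.exists_ball_le_block hV (a := 0) (l := n (q + 1))
      (by omega) hn
    rw [zero_add, Nat.Ico_zero_eq_range, h.sum_eq, one_mul] at hball
    push_cast at hx1 hx2
    rw [zero_add] at hx2
    rw [zero_mul] at hx1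
    have hr : compLen n c q ≤ n (q + 1) * period n c q := by
      rw [hlen]
      linarith
    have hr' : n (q + 1) * period n c q ≤ compLen n c q + gapLen n c (q + 1) := by
      rw [hlen]
      linarith
    have hn3 : (3 : ℝ) * period n c q ≤ n (q + 1) * period n c q :=
      mul_le_mul_of_nonneg_right (by exact_mod_cast hn) hp0.le
    have := hd.le_of_subset h hD hx (r := n (q + 1) * period n c q / 4) (by linarith) 4
      (S := piece n c q (z + gapLen n c (j + 1))) fun u hu =>
        ⟨by linarith [hu.1], by linarith [hu.2]⟩
    calc _ ≤ D ^ 4 * ν.real (piece n c q (z - compLen n c q)) :=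
          this.trans (mul_le_mul_of_nonneg_left hball (by positivity))
      _ ≤ D ^ 4 * (1 + R) * ν.real (piece n c q (z - compLen n c q)) := by
          rw [mul_assoc]
          exact mul_le_mul_of_nonneg_left
            (le_mul_of_one_le_left measureReal_nonneg (by linarith)) (by positivity)
  · have hn2 : n (q + 1) = 2 := by omega
    rw [hn2] at hlen
    norm_num at hlen
    -- The centre is an endpoint of the first child on the right, and ρ is the larger of δ_{q+1} and
    -- ε_{q+1}, so ρ is at least half a period. The open ball misses the far child on either side,
    -- and the ball of radius 16ρ covers the right component.
    obtain ⟨x, ρ, hx, hx1, hx2, hx3, hx4, hρ⟩ : ∃ x ρ : ℝ, x ∈ cantorSet n c ∧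
        z + gapLen n c (j + 1) ≤ x ∧ x ≤ z + gapLen n c (j + 1) + compLen n c (q + 1) ∧
        x + ρ ≤ z + gapLen n c (j + 1) + period n c q ∧ z - period n c q ≤ x - ρ ∧
        period n c q ≤ 2 * ρ := by
      rcases le_total (compLen n c (q + 1)) (gapLen n c (q + 1)) with hle | hle
      · refine ⟨z + gapLen n c (j + 1) + compLen n c (q + 1), gapLen n c (q + 1), ?_, ?_, ?_, ?_,
          ?_, ?_⟩
        · refine h.data.right_mem_cantorSet (q := q + 1) ?_
          rw [add_sub_cancel_right]
          exact h.data.gap_right_mem hz (by omega)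
        all_goals linarith
      · refine ⟨z + gapLen n c (j + 1), compLen n c (q + 1), ?_, ?_, ?_, ?_, ?_, ?_⟩
        · exact h.data.left_mem_cantorSet hK
        all_goals linarith
    have hball : ν.real (Metric.ball x ρ) ≤
        ν.real (piece n c (q + 1) (z + gapLen n c (j + 1)) ∪
          piece n c (q + 1) (z - compLen n c (q + 1))) := by
      refine h.mono fun u hu hur => ?_
      rw [Metric.mem_ball, Real.dist_eq, abs_lt] at hur
      rcases h.data.gap_empty hz hu with huz | huz
      · right
        obtain ⟨i, hi, hui⟩ := h.data.exists_mem_child hV hu ⟨by linarith, by linarith⟩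
        have hi1 : i = 1 := by
          by_contra hne
          have : i = 0 := by omega
          rw [this] at hui
          have := hui.2
          norm_num at this
          linarith
        rw [hi1] at hui
        convert hui using 1
        rw [hlen]
        push_cast
        ring_nf
      · left
        obtain ⟨i, hi, hui⟩ := h.data.exists_mem_child hK hu ⟨by linarith, by linarith⟩
        have hi1 : i = 0 := by
          by_contra hne
          have : i = 1 := by omega
          rw [this] at hui
          have := hui.1
          norm_num at this
          linarith
        rw [hi1] at hui
        simpa using hui
    have h3 := measureReal_union_le (μ := ν) (piece n c (q + 1) (z + gapLen n c (j + 1)))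
      (piece n c (q + 1) (z - compLen n c (q + 1)))
    have h4 : ν.real (piece n c (q + 1) (z - compLen n c (q + 1))) ≤
        ν.real (piece n c q (z - compLen n c q)) :=
      h.mono fun u _ hu => ⟨by linarith [hu.1], by linarith [hu.2]⟩
    have h5 := hR2 hn2
    have h6 := hd.le_of_subset h hD hx (r := ρ) (by linarith) 4
      (S := piece n c q (z + gapLen n c (j + 1))) fun u hu =>
        ⟨by linarith [hu.1], by linarith [hu.2]⟩
    refine h6.trans ?_
    rw [mul_assoc]
    refine mul_le_mul_of_nonneg_left ?_ (by positivity)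
    have h7 := mul_le_mul_of_nonneg_left h4 (show 0 ≤ 1 + R by linarith)
    linarith

/-- Here d counts the levels left before k + m_k - 1, and the induction on d iterates
`DoublingOn.gap_step`. -/
theorem DoublingOn.gap_compare_aux (hd : DoublingOn n c ν D) (h : IsWeighted n c p ν)
    (hD : 1 ≤ D) {j : ℕ} {z : ℝ} (hz : IsGap n c j z) (hk : j + 1 ∈ Lam n c) (d : ℕ) {q : ℕ}
    (hjq : j + 1 ≤ q) (hq : q + d + 1 = j + 1 + mIdx n c (j + 1)) :
    ν.real (piece n c q (z + gapLen n c (j + 1))) ≤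
      gapConst D (d + 1) * ν.real (piece n c q (z - compLen n c q)) := by
  have hlt := h.data.gapLen_lt hk (q := q) (by omega)
  have hR : 0 ≤ gapConst D d := zero_le_one.trans (one_le_gapConst hD d)
  refine hd.gap_step h hD hz hjq hlt hR fun hn2 => ?_
  cases d with
  | zero =>
    -- At the bottom s_k < n_{q+1} = 2 forces s_k = 1, so the block comparison concerns single
    -- children.
    obtain ⟨hs1, hsn, -, -⟩ := h.data.sIdx_bounds hk (q := q) (by omega)
    have := hd.block_across_gap h hD hz hk (q := q) (by omega)
    rw [show sIdx n c (j + 1) = 1 by omega] at this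
    rw [h.gap_right_succ hz hjq, h.gap_left_succ hz hjq, hn2]
    simpa [hn2, gapConst] using this
  | succ d => exact hd.gap_compare_aux h hD hz hk d (by omega) (by omega)

theorem DoublingOn.gap_compare_right (hd : DoublingOn n c ν D) (h : IsWeighted n c p ν)
    (hD : 1 ≤ D) {M : ℕ} (hM : ∀ k ∈ Lam n c, mIdx n c k ≤ M) {j : ℕ} {z : ℝ}
    (hz : IsGap n c j z) (hk : j + 1 ∈ Lam n c) {q : ℕ}
    (hjq : j + 1 ≤ q) (hq : q < j + 1 + mIdx n c (j + 1)) :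
    ν.real (piece n c q (z + gapLen n c (j + 1))) ≤
      gapConst D M * ν.real (piece n c q (z - compLen n c q)) := by
  have := hM _ hk
  refine (hd.gap_compare_aux h hD hz hk (j + mIdx n c (j + 1) - q) hjq (by omega)).trans
    (mul_le_mul_of_nonneg_right (gapConst_mono hD (by omega)) measureReal_nonneg)

theorem DoublingOn.gap_compare_left (hd : DoublingOn n c ν D) (h : IsWeighted n c p ν)
    (hD : 1 ≤ D) {M : ℕ} (hM : ∀ k ∈ Lam n c, mIdx n c k ≤ M) {j : ℕ} {z : ℝ}
    (hz : IsGap n c j z) (hk : j + 1 ∈ Lam n c) {q : ℕ}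
    (hjq : j + 1 ≤ q) (hq : q < j + 1 + mIdx n c (j + 1)) :
    ν.real (piece n c q (z - compLen n c q)) ≤
      gapConst D M * ν.real (piece n c q (z + gapLen n c (j + 1))) := by
  have := (hd.reflect h).gap_compare_right h.reflect hD hM (h.data.reflect_gap hz) hk hjq hq
  rw [map_reflect_real, map_reflect_real] at this
  convert this using 3
  · ring_nf
  · ring_nf

/-! ### Neighbouring entries, short blocks and long blocks. -/

theorem IsCantorData.zero_mem_leftSet (h : IsCantorData n c) (q : ℕ) : (0 : ℝ) ∈ leftSet n c q :=
  h.left_mem_leftSet (mem_leftSet_zero.2 rfl) (Nat.zero_le q)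

theorem DoublingOn.succ_le (hd : DoublingOn n c ν D) (h : IsWeighted n c p ν)
    (hD : 1 ≤ D) {M : ℕ} (hM : ∀ k ∈ Lam n c, mIdx n c k ≤ M) {q a : ℕ}
    (ha : a + 1 < n (q + 1)) : p (q + 1) (a + 1) ≤ gapConst D M * p (q + 1) a := by
  have h0 := h.data.zero_mem_leftSet q
  have hpos := h.piece_pos h0
  obtain ⟨z, hz⟩ : ∃ z, z = 0 + a * period n c q + compLen n c (q + 1) := ⟨_, rfl⟩
  have hgap : IsGap n c q z := ⟨0, h0, a, ha, hz⟩
  obtain ⟨e1, e2⟩ := h.gap_first h0 ha hz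
  refine le_of_mul_le_mul_right ?_ hpos
  rw [mul_assoc, ← e1, ← e2]
  by_cases hk : q + 1 ∈ Lam n c
  · obtain ⟨hm1, -, -⟩ := mIdx_mem h.data hk
    exact hd.gap_compare_right h hD hM hgap hk le_rfl (by omega)
  -- Outside Λ the gap is at least as long as a component: a ball of radius ε about z sees only the
  -- left component, and two doublings reach over the right one.
  have hδ := h.data.compLen_pos (q + 1)
  have hg := h.data.gapLen_pos q
  have hge : compLen n c (q + 1) ≤ gapLen n c (q + 1) := by
    by_contra hlt
    exact hk ⟨by omega, not_le.1 hlt⟩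
  have hp : period n c q = compLen n c (q + 1) + gapLen n c (q + 1) := rfl
  have hzl := h.data.gap_left_mem hgap le_rfl
  have hend := h.data.child_end_le (show a < n (q + 1) by omega)
  have hball : ν.real (Metric.ball z (gapLen n c (q + 1))) ≤
      ν.real (piece n c (q + 1) (z - compLen n c (q + 1))) := by
    refine h.mono fun u hu hur => ?_
    rw [Metric.mem_ball, Real.dist_eq, abs_lt] at hur
    have huz : u ≤ z := (h.data.gap_empty hgap hu).resolve_right fun h1 => by linarith
    obtain ⟨i, hi, hui⟩ := h.data.exists_mem_child h0 hu
      ⟨(cantorSet_subset hu).1, by linarith⟩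
    have hia : i = a := by
      rcases lt_trichotomy i a with hlt | heq | hlt
      · have := h.data.succ_mul_period_le q hlt
        linarith [hui.2]
      · exact heq
      · have := h.data.succ_mul_period_le q hlt
        linarith [hui.1]
    rw [hia] at hui
    rwa [hz, add_sub_cancel_right]
  have h1 := hd.le_of_subset h hD (h.data.right_mem_cantorSet hzl) hg 2
    (S := piece n c (q + 1) (z + gapLen n c (q + 1))) fun u hu =>
      ⟨by linarith [hu.1], by linarith [hu.2]⟩
  refine (h1.trans (mul_le_mul_of_nonneg_left hball (by positivity))).trans
    (mul_le_mul_of_nonneg_right ?_ measureReal_nonneg)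
  calc D ^ 2 ≤ D ^ 3 := pow_le_pow_right₀ hD (by omega)
    _ ≤ gapConst D M := gapConst_mono hD (Nat.zero_le M)

theorem DoublingOn.le_succ (hd : DoublingOn n c ν D) (h : IsWeighted n c p ν)
    (hD : 1 ≤ D) {M : ℕ} (hM : ∀ k ∈ Lam n c, mIdx n c k ≤ M) {q a : ℕ}
    (ha : a + 1 < n (q + 1)) : p (q + 1) a ≤ gapConst D M * p (q + 1) (a + 1) := by
  have := (hd.reflect h).succ_le h.reflect hD hM (q := q) (a := n (q + 1) - 2 - a) (by omega)
  unfold reflectWeight at this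
  convert this using 2
  · omega
  · congr 1
    omega

/-- Consecutive terms among the first `m` are comparable. -/
def NeighborComparable (K : ℝ) (m : ℕ) (f : ℕ → ℝ) : Prop :=
  ∀ a, a + 1 < m → f (a + 1) ≤ K * f a ∧ f a ≤ K * f (a + 1)

theorem NeighborComparable.le_pow {K : ℝ} {m : ℕ} {f : ℕ → ℝ} (h : NeighborComparable K m f)
    (hK : 1 ≤ K) (hf : ∀ i < m, 0 ≤ f i) {N i j : ℕ} (hi : i < m) (hj : j < m)
    (hij : i ≤ j + N) (hji : j ≤ i + N) : f i ≤ K ^ N * f j := by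
  induction N generalizing i with
  | zero =>
    have : i = j := by omega
    rw [this]
    simp
  | succ N ih =>
    have hjN : 0 ≤ K ^ N * f j := mul_nonneg (by positivity) (hf j hj)
    rw [pow_succ', mul_assoc]
    rcases lt_trichotomy i j with hlt | heq | hlt
    · exact (h i (by omega)).2.trans
        (mul_le_mul_of_nonneg_left (ih (by omega) (by omega) (by omega)) (by linarith))
    · exact (ih hi (by omega) (by omega)).trans (le_mul_of_one_le_left hjN hK)
    · obtain ⟨i, rfl⟩ : ∃ b, i = b + 1 := ⟨i - 1, by omega⟩
      exact (h i hi).1.trans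
        (mul_le_mul_of_nonneg_left (ih (by omega) (by omega) (by omega)) (by linarith))

theorem NeighborComparable.sum_le {K : ℝ} {m : ℕ} {f : ℕ → ℝ} (h : NeighborComparable K m f)
    (hK : 1 ≤ K) (hf : ∀ i < m, 0 ≤ f i) {N i j l : ℕ} (hi : i + l ≤ m) (hj : j + l ≤ m)
    (hij : i ≤ j + N) (hji : j ≤ i + N) :
    ∑ a ∈ Finset.Ico i (i + l), f a ≤ K ^ N * ∑ a ∈ Finset.Ico j (j + l), f a := by
  rw [Finset.sum_Ico_eq_sum_range, Finset.sum_Ico_eq_sum_range, add_tsub_cancel_left,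
    add_tsub_cancel_left, Finset.mul_sum]
  refine Finset.sum_le_sum fun a ha => ?_
  rw [Finset.mem_range] at ha
  exact h.le_pow hK hf (by omega) (by omega) (by omega) (by omega)

theorem DoublingOn.neighborComparable (hd : DoublingOn n c ν D) (h : IsWeighted n c p ν)
    (hD : 1 ≤ D) {M : ℕ} (hM : ∀ k ∈ Lam n c, mIdx n c k ≤ M) (q : ℕ) :
    NeighborComparable (gapConst D M) (n (q + 1)) (p (q + 1)) := fun _ ha =>
  ⟨hd.succ_le h hD hM ha, hd.le_succ h hD hM ha⟩

/-- Long blocks in one component. -/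
theorem DoublingOn.block_le (hd : DoublingOn n c ν D) (h : IsWeighted n c p ν)
    (hD : 1 ≤ D) {q i j l : ℕ} (hl : 3 ≤ l) (hi : i + l ≤ n (q + 1)) (hj : j + l ≤ n (q + 1))
    (hij : i ≤ j + l) (hji : j ≤ i + l) :
    ∑ a ∈ Finset.Ico i (i + l), p (q + 1) a ≤
      D ^ 4 * ∑ a ∈ Finset.Ico j (j + l), p (q + 1) a := by
  have h0 := h.data.zero_mem_leftSet q
  have hp0 := h.data.period_pos q
  have hg := h.data.gapLen_pos q
  have hp : period n c q = compLen n c (q + 1) + gapLen n c (q + 1) := rfl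
  obtain ⟨x, hx, hx1, hx2, hball⟩ := h.exists_ball_le_block h0 hj hl
  refine le_of_mul_le_mul_right ?_ (h.piece_pos h0)
  rw [mul_assoc]
  refine le_trans ?_ (mul_le_mul_of_nonneg_left hball (by positivity))
  have c1 := h.data.mul_period_le q hij
  have c2 := h.data.mul_period_le q hji
  have c3 := h.data.mul_period_le q hl
  push_cast at c1 c2 c3
  refine le_trans ?_ (hd.le_of_subset h hD hx (r := l * period n c q / 4) (by linarith) 4
    (S := Ioo (x - 2 ^ 4 * (l * period n c q / 4)) (x + 2 ^ 4 * (l * period n c q / 4)))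
    fun u hu => hu)
  refine h.sum_le h0 (fun a ha => ?_) fun a ha u hu => ?_
  · rw [Finset.mem_Ico] at ha
    omega
  · rw [Finset.mem_Ico] at ha
    have c4 := h.data.mul_period_le q ha.1
    have c5 := h.data.succ_mul_period_le q ha.2
    push_cast at c5
    exact ⟨by linarith [hu.1], by linarith [hu.2]⟩

/-- The constant for the comparison of the entries at both sides of a gap. -/
def crossConst (D : ℝ) (M : ℕ) : ℝ := 5 * D ^ 3 * gapConst D M ^ 6

theorem gapConst_le_crossConst {D : ℝ} (hD : 1 ≤ D) (M : ℕ) :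
    gapConst D M ^ 2 ≤ crossConst D M ∧ gapConst D M ≤ crossConst D M ∧ 1 ≤ crossConst D M := by
  have hG := one_le_gapConst hD M
  have h1 : (1 : ℝ) ≤ D ^ 3 := one_le_pow₀ hD
  have h2 : gapConst D M ^ 2 ≤ gapConst D M ^ 6 := pow_le_pow_right₀ hG (by omega)
  have h3 : gapConst D M ≤ gapConst D M ^ 2 := le_self_pow₀ hG (by omega)
  have h4 : gapConst D M ^ 6 ≤ crossConst D M := by
    rw [crossConst]
    exact le_mul_of_one_le_left (by positivity) (by linarith)
  exact ⟨by linarith, by linarith, by linarith⟩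

/-- The two weights describe the children on either side of a gap of level k. Below level k + m_k
these children and their parents are both comparable, costing the square of `gapConst`. At level k +
m_k only blocks of s_k children are comparable; since s_k ≤ 5, each entry of the left block is at
most five steps from its last entry. -/
theorem DoublingOn.cross_le (hd : DoublingOn n c ν D) (h : IsWeighted n c p ν)
    (hD : 1 ≤ D) {M : ℕ} (hM : ∀ k ∈ Lam n c, mIdx n c k ≤ M) {j : ℕ} (hk : j + 1 ∈ Lam n c)
    {q : ℕ} (hjq : j + 1 ≤ q) (hq : q + 1 < j + 1 + mIdx n c (j + 1) ∨
      q + 1 = j + 1 + mIdx n c (j + 1) ∧ sIdx n c (j + 1) ≤ 5) :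
    p (q + 1) 0 ≤ crossConst D M * p (q + 1) (n (q + 1) - 1) := by
  have h2 := h.data.two_le (q + 1) (by omega)
  have h2' := h.data.two_le (j + 1) (by omega)
  have hz : IsGap n c j (0 + (0 : ℕ) * period n c j + compLen n c (j + 1)) :=
    ⟨0, h.data.zero_mem_leftSet j, 0, by omega, rfl⟩
  set z : ℝ := 0 + (0 : ℕ) * period n c j + compLen n c (j + 1)
  have hG := one_le_gapConst hD M
  have hB := h.piece_pos (h.data.gap_right_mem hz hjq)
  have hlast := h.pos q (n (q + 1) - 1) (by omega)
  have hcmp := hd.gap_compare_left h hD hM hz hk hjq (by omega)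
  refine le_of_mul_le_mul_right ?_ hB
  rcases hq with hq | ⟨hq, hs5⟩
  · have h1 := hd.gap_compare_right h hD hM hz hk (q := q + 1) (by omega) hq
    rw [h.gap_right_succ hz hjq, h.gap_left_succ hz hjq] at h1
    calc _ ≤ _ := h1
      _ ≤ gapConst D M * (p (q + 1) (n (q + 1) - 1) *
          (gapConst D M * ν.real (piece n c q (z + gapLen n c (j + 1))))) := by gcongr
      _ = gapConst D M ^ 2 * p (q + 1) (n (q + 1) - 1) *
          ν.real (piece n c q (z + gapLen n c (j + 1))) := by ring
      _ ≤ _ := by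
        have := (gapConst_le_crossConst hD M).1
        gcongr
  · obtain ⟨hs1, hsn, -, -⟩ := h.data.sIdx_bounds hk hq
    have h1 := hd.block_across_gap h hD hz hk hq
    set s := sIdx n c (j + 1)
    have h3 : p (q + 1) 0 ≤ ∑ i ∈ Finset.Ico 0 s, p (q + 1) i := by
      refine Finset.single_le_sum (f := fun i => p (q + 1) i) (fun i hi => ?_) ?_
      · rw [Finset.mem_Ico] at hi
        exact h.entry_nonneg q i (by omega)
      · rw [Finset.mem_Ico]
        omega
    have h4 : ∑ i ∈ Finset.Ico (n (q + 1) - s) (n (q + 1)), p (q + 1) i ≤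
        5 * (gapConst D M ^ 5 * p (q + 1) (n (q + 1) - 1)) := by
      have h5 : ∑ i ∈ Finset.Ico (n (q + 1) - s) (n (q + 1)), p (q + 1) i ≤
          ∑ _i ∈ Finset.Ico (n (q + 1) - s) (n (q + 1)),
            gapConst D M ^ 5 * p (q + 1) (n (q + 1) - 1) := by
        refine Finset.sum_le_sum fun i hi => ?_
        rw [Finset.mem_Ico] at hi
        exact (hd.neighborComparable h hD hM q).le_pow hG (h.entry_nonneg q) (by omega)
          (by omega) (by omega) (by omega)
      rw [Finset.sum_const, nsmul_eq_mul, Nat.card_Ico,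
        show n (q + 1) - (n (q + 1) - s) = s by omega] at h5
      have hs5' : (s : ℝ) ≤ 5 := by exact_mod_cast hs5
      exact h5.trans (mul_le_mul_of_nonneg_right hs5' (by positivity))
    calc _ ≤ (∑ i ∈ Finset.Ico 0 s, p (q + 1) i) *
          ν.real (piece n c q (z + gapLen n c (j + 1))) :=
          mul_le_mul_of_nonneg_right h3 hB.le
      _ ≤ _ := h1
      _ ≤ D ^ 3 * (5 * (gapConst D M ^ 5 * p (q + 1) (n (q + 1) - 1)) *
          (gapConst D M * ν.real (piece n c q (z + gapLen n c (j + 1))))) := by gcongr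
      _ = _ := by rw [crossConst]; ring

theorem DoublingOn.repeat_neighborComparable (hd : DoublingOn n c ν D) (h : IsWeighted n c p ν)
    (hD : 1 ≤ D) {M : ℕ} (hM : ∀ k ∈ Lam n c, mIdx n c k ≤ M) {j : ℕ} (hk : j + 1 ∈ Lam n c)
    {q : ℕ} (hjq : j + 1 ≤ q) (hq : q + 1 < j + 1 + mIdx n c (j + 1) ∨
      q + 1 = j + 1 + mIdx n c (j + 1) ∧ sIdx n c (j + 1) ≤ 5) :
    NeighborComparable (crossConst D M) (n (q + 1) + n (q + 1))
      (repeatSeq (n (q + 1)) (p (q + 1))) := by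
  have hGK := (gapConst_le_crossConst hD M).2.1
  have h2 := h.data.two_le (q + 1) (by omega)
  have key : NeighborComparable (crossConst D M) (n (q + 1)) (p (q + 1)) := fun a ha => by
    obtain ⟨h3, h4⟩ := hd.neighborComparable h hD hM q a ha
    exact ⟨h3.trans (mul_le_mul_of_nonneg_right hGK (h.entry_nonneg q _ (by omega))),
      h4.trans (mul_le_mul_of_nonneg_right hGK (h.entry_nonneg q _ (by omega)))⟩
  intro a ha
  unfold repeatSeq
  rcases lt_trichotomy (a + 1) (n (q + 1)) with hlt | heq | hlt
  · rw [if_pos hlt, if_pos (by omega)]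
    exact key a hlt
  · rw [if_neg (by omega), if_pos (by omega), show a + 1 - n (q + 1) = 0 by omega,
      show a = n (q + 1) - 1 by omega]
    have h3 := (hd.reflect h).cross_le h.reflect hD hM hk hjq hq
    simp only [reflectWeight, Nat.sub_zero, Nat.sub_self] at h3
    exact ⟨hd.cross_le h hD hM hk hjq hq, h3⟩
  · rw [if_neg (by omega), if_neg (by omega), show a + 1 - n (q + 1) = a - n (q + 1) + 1 by omega]
    exact key _ (by omega)

theorem sum_repeatSeq (m : ℕ) (f : ℕ → ℝ) (i l : ℕ) :
    ∑ a ∈ Finset.Ico i (i + l), repeatSeq m f a =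
      ∑ a ∈ Finset.Ico i (min m (i + l)), f a + ∑ a ∈ Finset.Ico (i - m) (i + l - m), f a := by
  rw [← sum_repeatSeq_left (m := m) f (min_le_left m (i + l)), 
    ← sum_repeatSeq_right (m := m) f (Finset.Ico (i - m) (i + l - m)), ← Finset.sum_union]
  · refine Finset.sum_congr ?_ fun _ _ => rfl
    ext a
    simp only [Finset.mem_union, Finset.mem_map, Finset.mem_Ico, addLeftEmbedding_apply]
    constructor
    · intro ha
      rcases Nat.lt_or_ge a m with hlt | hge
      · left; omega
      · exact Or.inr ⟨a - m, by omega, by omega⟩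
    · rintro (ha | ⟨b, hb, rfl⟩) <;> omega
  · rw [Finset.disjoint_left]
    intro a ha hb
    simp only [Finset.mem_map, Finset.mem_Ico, addLeftEmbedding_apply] at ha hb
    obtain ⟨b, hb, rfl⟩ := hb
    omega

/-- Long blocks in two components which are separated by a gap. -/
theorem DoublingOn.repeat_block_le (hd : DoublingOn n c ν D) (h : IsWeighted n c p ν)
    (hD : 1 ≤ D) {M : ℕ} (hM : ∀ k ∈ Lam n c, mIdx n c k ≤ M) {j : ℕ} (hk : j + 1 ∈ Lam n c)
    {q : ℕ} (hjq : j + 1 ≤ q) (hq : q < j + 1 + mIdx n c (j + 1)) {i i' l : ℕ} (hl : 6 ≤ l)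
    (hgap : gapLen n c (j + 1) ≤ (l + 1) * period n c q)
    (hi : i + l ≤ n (q + 1) + n (q + 1)) (hi' : i' + l ≤ n (q + 1) + n (q + 1))
    (hii' : i ≤ i' + l) (hi'i : i' ≤ i + l) :
    ∑ a ∈ Finset.Ico i (i + l), repeatSeq (n (q + 1)) (p (q + 1)) a ≤
      (1 + gapConst D M) * D ^ 6 *
        ∑ a ∈ Finset.Ico i' (i' + l), repeatSeq (n (q + 1)) (p (q + 1)) a := by
  have h2' := h.data.two_le (j + 1) (by omega)
  have hz : IsGap n c j (0 + (0 : ℕ) * period n c j + compLen n c (j + 1)) :=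
    ⟨0, h.data.zero_mem_leftSet j, 0, by omega, rfl⟩
  set z : ℝ := 0 + (0 : ℕ) * period n c j + compLen n c (j + 1)
  have hG := one_le_gapConst hD M
  have hVm := h.data.gap_left_mem hz hjq
  have hKm := h.data.gap_right_mem hz hjq
  have hA := h.piece_pos hVm
  have hB := h.piece_pos hKm
  have hBA := hd.gap_compare_right h hD hM hz hk hjq hq
  have hAB := hd.gap_compare_left h hD hM hz hk hjq hq
  have hp0 := h.data.period_pos q
  have hg := h.data.gapLen_pos q
  have hg' := h.data.gapLen_pos j
  have hδ := h.data.compLen_pos (q + 1)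
  have hp : period n c q = compLen n c (q + 1) + gapLen n c (q + 1) := rfl
  have hlen := h.data.compLen_eq q
  rw [sum_repeatSeq, sum_repeatSeq]
  set A := ν.real (piece n c q (z - compLen n c q))
  set B := ν.real (piece n c q (z + gapLen n c (j + 1)))
  set V := z - compLen n c q with hV
  have hK : z + gapLen n c (j + 1) =
      V + n (q + 1) * period n c q + gapLen n c (j + 1) - gapLen n c (q + 1) := by
    rw [hV, hlen, hp]
    ring
  set G := gapConst D M
  have nonneg : ∀ a b, b ≤ n (q + 1) → 0 ≤ ∑ t ∈ Finset.Ico a b, p (q + 1) t := fun a b hb =>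
    Finset.sum_nonneg fun t ht => h.entry_nonneg q t (by rw [Finset.mem_Ico] at ht; omega)
  have n1 := nonneg i (min (n (q + 1)) (i + l)) (by omega)
  have n2 := nonneg (i - n (q + 1)) (i + l - n (q + 1)) (by omega)
  have n3 := nonneg i' (min (n (q + 1)) (i' + l)) (by omega)
  have n4 := nonneg (i' - n (q + 1)) (i' + l - n (q + 1)) (by omega)
  set X₁ := ∑ t ∈ Finset.Ico i (min (n (q + 1)) (i + l)), p (q + 1) t with hX₁
  set X₂ := ∑ t ∈ Finset.Ico (i - n (q + 1)) (i + l - n (q + 1)), p (q + 1) t with hX₂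
  set Y₁ := ∑ t ∈ Finset.Ico i' (min (n (q + 1)) (i' + l)), p (q + 1) t with hY₁
  set Y₂ := ∑ t ∈ Finset.Ico (i' - n (q + 1)) (i' + l - n (q + 1)), p (q + 1) t with hY₂
  have c1 := h.data.mul_period_le q hii'
  have c2 := h.data.mul_period_le q hi'i
  have c3 := h.data.mul_period_le q hl
  push_cast at c1 c2 c3
  -- Enlarging 64 times turns the radius l'/4 into 16 l' ≥ 8 l periods. This covers both parts of
  -- the first block, the gap being at most l + 1 periods.
  have cover : ∀ x ∈ cantorSet n c, ∀ l' : ℕ, l ≤ 2 * l' → 3 ≤ l' →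
      V + i' * period n c q - period n c q ≤ x →
      x ≤ V + (i' + l) * period n c q + gapLen n c (j + 1) →
      X₁ * A ≤ D ^ 6 * ν.real (Metric.ball x (l' * period n c q / 4)) ∧
      X₂ * B ≤ D ^ 6 * ν.real (Metric.ball x (l' * period n c q / 4)) := by
    intro x hx l' hll' hl' hx1 hx2
    have c4 := h.data.mul_period_le q hll'
    push_cast at c4
    have hS := hd.le_of_subset h hD hx (r := l' * period n c q / 4) (by linarith) 6
      (S := Ioo (x - 2 ^ 6 * (l' * period n c q / 4)) (x + 2 ^ 6 * (l' * period n c q / 4)))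
      fun u hu => hu
    constructor
    · refine (h.sum_le hVm (fun t ht => ?_) fun t ht u hu => ?_).trans hS
      · rw [Finset.mem_Ico] at ht
        omega
      · rw [Finset.mem_Ico] at ht
        have c5 := h.data.mul_period_le q ht.1
        have c6 := h.data.succ_mul_period_le q (show t < i + l by omega)
        push_cast at c6
        exact ⟨by linarith [hu.1], by linarith [hu.2]⟩
    · refine (h.sum_le hKm (fun t ht => ?_) fun t ht u hu => ?_).trans hS
      · rw [Finset.mem_Ico] at ht
        omega
      · rw [Finset.mem_Ico] at ht
        have c5 := h.data.mul_period_le q (show i ≤ n (q + 1) + t by omega)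
        have c6 := h.data.succ_mul_period_le q (show n (q + 1) + t < i + l by omega)
        push_cast at c5 c6
        rw [hK] at hu
        exact ⟨by linarith [hu.1], by linarith [hu.2]⟩
  have hG0 : 0 ≤ (1 + G) * D ^ 6 := by positivity
  have hD6 : 0 ≤ D ^ 6 := by positivity
  -- One side of the junction holds at least half of the second block, hence at least three
  -- components because l ≥ 6. A ball is placed there, and the masses A and B of the parents are
  -- exchanged at the cost of G.
  rcases le_total l (2 * (min (n (q + 1)) (i' + l) - i')) with hhalf | hhalf
  · obtain ⟨x, hx, hx1, hx2, hball⟩ := h.exists_ball_le_block hVm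
      (a := i') (l := min (n (q + 1)) (i' + l) - i') (by omega) (by omega)
    rw [show i' + (min (n (q + 1)) (i' + l) - i') = min (n (q + 1)) (i' + l) by omega,
      ← hY₁] at hball
    have c4 := h.data.mul_period_le q
      (show i' + (min (n (q + 1)) (i' + l) - i') ≤ i' + l by omega)
    push_cast at c4
    obtain ⟨r1, r2⟩ := cover x hx _ hhalf (by omega) (by linarith) (by linarith)
    have r3 := mul_le_mul_of_nonneg_left hball hD6
    have r4 : X₂ * A ≤ G * (D ^ 6 * (Y₁ * A)) :=
      calc X₂ * A ≤ X₂ * (G * B) := mul_le_mul_of_nonneg_left hAB n2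
        _ = G * (X₂ * B) := by ring
        _ ≤ _ := mul_le_mul_of_nonneg_left (r2.trans r3) (by linarith)
    have r5 : X₁ + X₂ ≤ (1 + G) * D ^ 6 * Y₁ := by
      refine le_of_mul_le_mul_right ?_ hA
      linarith
    exact r5.trans (mul_le_mul_of_nonneg_left (by linarith) hG0)
  · obtain ⟨l', hl'⟩ : ∃ l', l' = i' + l - n (q + 1) - (i' - n (q + 1)) := ⟨_, rfl⟩
    obtain ⟨x, hx, hx1, hx2, hball⟩ := h.exists_ball_le_block hKm
      (a := i' - n (q + 1)) (l := l') (by omega) (by omega)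
    rw [show i' - n (q + 1) + l' = i' + l - n (q + 1) by omega, ← hY₂] at hball
    have c4 := h.data.mul_period_le q
      (show n (q + 1) + ((i' - n (q + 1)) + l') ≤ i' + l by omega)
    have c5 := h.data.mul_period_le q (show i' ≤ n (q + 1) + (i' - n (q + 1)) by omega)
    push_cast at c4 c5
    rw [hK] at hx1 hx2
    obtain ⟨r1, r2⟩ := cover x hx l' (by omega) (by omega) (by linarith) (by linarith)
    have r3 := mul_le_mul_of_nonneg_left hball hD6
    have r4 : X₁ * B ≤ G * (D ^ 6 * (Y₂ * B)) :=
      calc X₁ * B ≤ X₁ * (G * A) := mul_le_mul_of_nonneg_left hBA n1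
        _ = G * (X₁ * A) := by ring
        _ ≤ _ := mul_le_mul_of_nonneg_left (r1.trans r3) (by linarith)
    have r5 : X₁ + X₂ ≤ (1 + G) * D ^ 6 * Y₂ := by
      refine le_of_mul_le_mul_right ?_ hB
      linarith
    exact r5.trans (mul_le_mul_of_nonneg_left (by linarith) hG0)

theorem BlockDoubling.of_le {C : ℝ} {s m : ℕ} {f : ℕ → ℝ}
    (h : ∀ i j l, s ≤ l → i ≤ j + l → j ≤ i + l → i + l ≤ m → j + l ≤ m →
      ∑ a ∈ Finset.Ico i (i + l), f a ≤ C * ∑ a ∈ Finset.Ico j (j + l), f a) :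
    BlockDoubling C s m f := fun i j l h1 h2 h3 h4 =>
  ⟨h i j l h1 (by omega) h3 (by omega) h4, h j i l h1 h3 (by omega) h4 (by omega)⟩

theorem DoublingOn.repeat_blockDoubling (hd : DoublingOn n c ν D) (h : IsWeighted n c p ν)
    (hD : 1 ≤ D) {M : ℕ} (hM : ∀ k ∈ Lam n c, mIdx n c k ≤ M) {j : ℕ} (hk : j + 1 ∈ Lam n c)
    {q s : ℕ} (hjq : j + 1 ≤ q) (hq : q + 1 < j + 1 + mIdx n c (j + 1) ∨
      q + 1 = j + 1 + mIdx n c (j + 1) ∧ sIdx n c (j + 1) ≤ s) {C : ℝ}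
    (hC1 : crossConst D M ^ 5 ≤ C) (hC2 : (1 + gapConst D M) * D ^ 6 ≤ C) :
    BlockDoubling C s (n (q + 1) + n (q + 1)) (repeatSeq (n (q + 1)) (p (q + 1))) := by
  refine BlockDoubling.of_le fun i i' l hs h1 h2 h3 h4 => ?_
  have hnn : 0 ≤ ∑ a ∈ Finset.Ico i' (i' + l), repeatSeq (n (q + 1)) (p (q + 1)) a :=
    Finset.sum_nonneg fun t ht => h.repeatSeq_nonneg q t (by rw [Finset.mem_Ico] at ht; omega)
  -- Blocks with l ≤ 5 are shifted by at most five positions and compared entrywise. At level k +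
  -- m_k such blocks occur only if s_k ≤ l ≤ 5, as `DoublingOn.cross_le` requires.
  rcases Nat.lt_or_ge l 6 with hl | hl
  · refine ((hd.repeat_neighborComparable h hD hM hk hjq (hq.imp_right fun hq =>
      ⟨hq.1, by omega⟩)).sum_le (gapConst_le_crossConst hD M).2.2 (h.repeatSeq_nonneg q)
      (N := 5) h3 h4 (by omega) (by omega)).trans (mul_le_mul_of_nonneg_right hC1 hnn)
  · refine (hd.repeat_block_le h hD hM hk hjq (by omega) hl ?_ h3 h4 h1 h2).trans
      (mul_le_mul_of_nonneg_right hC2 hnn)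
    have hg := h.data.gapLen_pos q
    have hp0 := h.data.period_pos q
    have hp : period n c q = compLen n c (q + 1) + gapLen n c (q + 1) := rfl
    have hl0 : 0 ≤ l * period n c q := by positivity
    rcases hq with hq | ⟨hq, hsl⟩
    · have := h.data.gapLen_lt hk hq
      linarith
    · obtain ⟨-, -, -, h5⟩ := h.data.sIdx_bounds hk hq
      have := h.data.mul_period_le q (hsl.trans hs)
      linarith

theorem DoublingOn.blockDoubling (hd : DoublingOn n c ν D) (h : IsWeighted n c p ν)
    (hD : 1 ≤ D) {M : ℕ} (hM : ∀ k ∈ Lam n c, mIdx n c k ≤ M) (q : ℕ) {C : ℝ}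
    (hC1 : gapConst D M ^ 2 ≤ C) (hC2 : D ^ 4 ≤ C) :
    BlockDoubling C 1 (n (q + 1)) (p (q + 1)) := by
  refine BlockDoubling.of_le fun i i' l hs h1 h2 h3 h4 => ?_
  have hnn : 0 ≤ ∑ a ∈ Finset.Ico i' (i' + l), p (q + 1) a :=
    Finset.sum_nonneg fun t ht => h.entry_nonneg q t (by rw [Finset.mem_Ico] at ht; omega)
  rcases Nat.lt_or_ge l 3 with hl | hl
  · exact ((hd.neighborComparable h hD hM q).sum_le (one_le_gapConst hD M) (h.entry_nonneg q)
      (N := 2) h3 h4 (by omega) (by omega)).trans (mul_le_mul_of_nonneg_right hC1 hnn)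
  · exact (hd.block_le h hD hl h3 h4 h1 h2).trans (mul_le_mul_of_nonneg_right hC2 hnn)

theorem DoublingOn.exists_uniformWeights (hd : DoublingOn n c ν D) (h : IsWeighted n c p ν)
    (hD : 1 ≤ D) {M : ℕ} (hM : ∀ k ∈ Lam n c, mIdx n c k ≤ M) :
    ∃ C, 1 < C ∧ UniformWeights n c p C := by
  have hG := one_le_gapConst hD M
  have hK := (gapConst_le_crossConst hD M).2.2
  have p1 : 0 ≤ gapConst D M ^ 2 := by positivity
  have p2 : 0 ≤ D ^ 4 := by positivity
  have p3 : 0 ≤ crossConst D M ^ 5 := by positivity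
  have p4 : 0 < (1 + gapConst D M) * D ^ 6 := by positivity
  refine ⟨1 + gapConst D M ^ 2 + D ^ 4 + crossConst D M ^ 5 + (1 + gapConst D M) * D ^ 6,
    by linarith, fun q => hd.blockDoubling h hD hM q (by linarith) (by linarith), ?_, ?_⟩
  · intro k hk t ht1 ht2
    obtain ⟨j, rfl⟩ : ∃ j, k = j + 1 := ⟨k - 1, by have := hk.1; omega⟩
    obtain ⟨t, rfl⟩ : ∃ t', t = t' + 1 := ⟨t - 1, by omega⟩
    exact hd.repeat_blockDoubling h hD hM hk (q := j + 1 + t) (by omega) (Or.inl (by omega))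
      (by linarith) (by linarith)
  · intro k hk
    obtain ⟨hm1, -, -⟩ := mIdx_mem h.data hk
    obtain ⟨j, rfl⟩ : ∃ j, k = j + 1 := ⟨k - 1, by have := hk.1; omega⟩
    obtain ⟨t, ht⟩ : ∃ t, mIdx n c (j + 1) = t + 1 := ⟨mIdx n c (j + 1) - 1, by omega⟩
    rw [ht]
    exact hd.repeat_blockDoubling h hD hM hk (q := j + 1 + t) (by omega)
      (Or.inr ⟨by omega, le_rfl⟩) (by linarith) (by linarith)

end Necessity

/-! ### The measure `μ_P` -/

section CantorMeasure

variable {n : ℕ → ℕ} {c : ℕ → ℝ} {P : (k : ℕ) → Fin (n k) → ℝ}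

/-- The measure `μ_P` as a measure on the real line. -/
def lineMeasure (n : ℕ → ℕ) (c : ℕ → ℝ) (P : (k : ℕ) → Fin (n k) → ℝ) : Measure ℝ :=
  (cantorMeasure n c P).map Subtype.val

theorem lineMeasure_apply {S : Set ℝ} (hS : MeasurableSet S) :
    lineMeasure n c P S = cantorMeasure n c P (Subtype.val ⁻¹' S) :=
  Measure.map_apply measurable_subtype_coe hS

theorem lineMeasure_ball (x : cantorSet n c) (r : ℝ) :
    lineMeasure n c P (Metric.ball (x : ℝ) r) = cantorMeasure n c P (Metric.ball x r) :=
  lineMeasure_apply Metric.isOpen_ball.measurableSet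

theorem isWeighted_lineMeasure (h : IsCantorData n c) (hP : ∀ k, 1 ≤ k → IsPosProb (P k)) :
    IsWeighted n c (fun k => entry (P k)) (lineMeasure n c P) where
  data := h
  pos q _ hi := entry_pos (hP (q + 1) (by omega)).1 hi
  sum_eq q := by
    rw [Finset.sum_range, ← (hP (q + 1) (by omega)).2]
    refine Finset.sum_congr rfl fun i _ => ?_
    rw [entry, dif_pos i.2]
  prob := by
    have := isProbabilityMeasure_cantorMeasure h hP
    exact Measure.isProbabilityMeasure_map measurable_subtype_coe.aemeasurable
  null := by
    rw [lineMeasure_apply measurableSet_cantorSet.compl]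
    convert measure_empty (μ := cantorMeasure n c P)
    ext x
    simp
  child q L hL i hi := by
    obtain ⟨w, rfl⟩ := hL
    obtain ⟨v, rfl, hv⟩ := exists_initWord_eq w hi
    have h1 : piece n c (q + 1) (leftEnd n c (initWord v) + i * period n c q) =
        component n c v := by
      rw [component, piece, leftEnd_succ, hv]
      rfl
    have h2 : piece n c q (leftEnd n c (initWord v)) = component n c (initWord v) := rfl
    show (lineMeasure n c P).real (piece n c (q + 1) (leftEnd n c (initWord v) + _)) =
      _ * (lineMeasure n c P).real (piece n c q (leftEnd n c (initWord v)))
    rw [h1, h2, measureReal_def, measureReal_def, lineMeasure_apply (measurableSet_component _),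
      lineMeasure_apply (measurableSet_component _), cantorMeasure_component h hP,
      ENNReal.toReal_mul, hv, ENNReal.toReal_ofReal ((hP (q + 1) (by omega)).1 _).le,
      entry, dif_pos hi]

theorem IsWeighted.ball_pos {p : ℕ → ℕ → ℝ} {ν : Measure ℝ} (h : IsWeighted n c p ν) {x r : ℝ}
    (hx : x ∈ cantorSet n c) (hr : 0 < r) : 0 < ν.real (Metric.ball x r) := by
  obtain ⟨q, hq⟩ := exists_pow_lt_of_lt_one hr (by norm_num : (1 / 2 : ℝ) < 1)
  obtain ⟨L, hL, hxL⟩ := exists_mem_piece hx q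
  refine (h.piece_pos hL).trans_le (h.mono fun u _ hu => ?_)
  have := h.data.compLen_le_pow q
  rw [Metric.mem_ball, Real.dist_eq, abs_lt]
  constructor <;> linarith [hu.1, hu.2, hxL.1, hxL.2]

theorem isDoubling_cantorMeasure_iff (h : IsCantorData n c)
    (hP : ∀ k, 1 ≤ k → IsPosProb (P k)) : IsDoubling (cantorMeasure n c P) ↔
      ∃ D, 1 ≤ D ∧ DoublingOn n c (lineMeasure n c P) D := by
  have hw := isWeighted_lineMeasure h hP
  have hprob := hw.prob
  have hprob' := isProbabilityMeasure_cantorMeasure h hP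
  constructor
  · rintro ⟨D, hD, hd⟩
    refine ⟨D, hD, fun x hx r hr => ?_⟩
    obtain ⟨-, h2, h3⟩ := hd ⟨x, hx⟩ r hr
    have := ENNReal.toReal_mono h3.ne h2
    rw [ENNReal.toReal_mul, ENNReal.toReal_ofReal (by linarith)] at this
    rw [measureReal_def, measureReal_def]
    exact (lineMeasure_ball (P := P) ⟨x, hx⟩ (2 * r)).symm ▸
      (lineMeasure_ball (P := P) ⟨x, hx⟩ r).symm ▸ this
  · rintro ⟨D, hD, hd⟩
    refine ⟨D, hD, fun x r hr => ⟨?_, ?_, ?_⟩⟩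
    · rw [← lineMeasure_ball]
      exact (ENNReal.toReal_pos_iff.1 (hw.ball_pos x.2 (by linarith))).1
    · have := hd x x.2 r hr
      rw [← lineMeasure_ball, ← lineMeasure_ball, ← ENNReal.toReal_le_toReal
        (measure_ne_top _ _) (ENNReal.mul_ne_top ENNReal.ofReal_ne_top (measure_ne_top _ _)),
        ENNReal.toReal_mul, ENNReal.toReal_ofReal (by linarith)]
      exact this
    · exact ENNReal.mul_lt_top ENNReal.ofReal_lt_top (measure_lt_top _ _)

theorem uniformWeights_entry_iff (h : IsCantorData n c) (hP : ∀ k, 1 ≤ k → IsPosProb (P k))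
    {C : ℝ} (hC : 1 < C) : UniformWeights n c (fun k => entry (P k)) C ↔
      (∀ k, 1 ≤ k → IsUniform C (P k)) ∧
      ∀ k ∈ Lam n c, (∀ t, 1 ≤ t → t < mIdx n c k → IsUniform C (twice (P (k + t)))) ∧
        IsUniformFrom C (sIdx n c k) (twice (P (k + mIdx n c k))) := by
  have hC0 : 0 < C := by linarith
  have htwice : ∀ k, 1 ≤ k → ∀ s, 1 ≤ s → (IsUniformFrom C s (twice (P k)) ↔
      BlockDoubling C s (n k + n k) (repeatSeq (n k) (entry (P k)))) := by
    intro k hk s hs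
    have hpos : ∀ i, 0 < twice (P k) i := fun i => by
      rw [twice]
      refine Fin.addCases (fun a => ?_) (fun a => ?_) i
      · rw [Fin.append_left]
        exact (hP k hk).1 a
      · rw [Fin.append_right]
        exact (hP k hk).1 a
    rw [isUniformFrom_iff hpos hC0 hs]
    exact ⟨fun H => H.congr fun i hi => entry_twice _ hi,
      fun H => H.congr fun i hi => (entry_twice _ hi).symm⟩
  constructor
  · intro U
    refine ⟨fun k hk => ?_, fun k hk => ⟨fun t ht1 ht2 => ?_, ?_⟩⟩
    · obtain ⟨q, rfl⟩ : ∃ q, k = q + 1 := ⟨k - 1, by omega⟩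
      exact (isUniformFrom_iff (hP _ hk).1 hC0 le_rfl).2 (U.single q)
    · exact (htwice _ (by omega) 1 le_rfl).2 (U.inner k hk t ht1 ht2)
    · have := hk.1
      exact (htwice _ (by omega) _ (sIdx_mem h hk).1).2 (U.last k hk)
  · rintro ⟨H1, H2⟩
    refine ⟨fun q => ?_, fun k hk t ht1 ht2 => ?_, fun k hk => ?_⟩
    · exact (isUniformFrom_iff (hP _ (by omega)).1 hC0 le_rfl).1 (H1 (q + 1) (by omega))
    · exact (htwice _ (by omega) 1 le_rfl).1 ((H2 k hk).1 t ht1 ht2)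
    · have := hk.1
      exact (htwice _ (by omega) _ (sIdx_mem h hk).1).1 (H2 k hk).2

end CantorMeasure

end

end UniformCantor

/-! ### The equivalence. -/

theorem corollary2 (n : ℕ → ℕ) (c : ℕ → ℝ) (hnc : UniformCantor.IsCantorData n c)
    (P : (k : ℕ) → Fin (n k) → ℝ) (hP : ∀ k, 1 ≤ k → UniformCantor.IsPosProb (P k))
    (hm : BddAbove (UniformCantor.mIdx n c '' UniformCantor.Lam n c)) :
    UniformCantor.IsDoubling (UniformCantor.cantorMeasure n c P) ↔
      ∃ C : ℝ, 1 < C ∧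
        (∀ k, 1 ≤ k → UniformCantor.IsUniform C (P k)) ∧
        (∀ k ∈ UniformCantor.Lam n c,
          (∀ t, 1 ≤ t → t < UniformCantor.mIdx n c k →
            UniformCantor.IsUniform C (UniformCantor.twice (P (k + t)))) ∧
          UniformCantor.IsUniformFrom C (UniformCantor.sIdx n c k)
            (UniformCantor.twice (P (k + UniformCantor.mIdx n c k)))) := by
  obtain ⟨M, hM⟩ := hm
  replace hM : ∀ k ∈ UniformCantor.Lam n c, UniformCantor.mIdx n c k ≤ M :=
    fun k hk => hM (Set.mem_image_of_mem _ hk)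
  have hw := UniformCantor.isWeighted_lineMeasure hnc hP
  rw [UniformCantor.isDoubling_cantorMeasure_iff hnc hP]
  constructor
  · rintro ⟨D, hD, hd⟩
    obtain ⟨C, hC, U⟩ := hd.exists_uniformWeights hw hD hM
    exact ⟨C, hC, (UniformCantor.uniformWeights_entry_iff hnc hP hC).1 U⟩
  · rintro ⟨C, hC, H⟩
    have U := (UniformCantor.uniformWeights_entry_iff hnc hP hC).2 H
    have h1 : (1 : ℝ) ≤ (1 + 2 * C) ^ 8 := one_le_pow₀ (by linarith)
    have h2 : (1 : ℝ) ≤ (C ^ (M + 1)) ^ 2 := one_le_pow₀ (one_le_pow₀ hC.le)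
    exact ⟨_, by nlinarith, fun x hx r hr => hw.ball_le U hC.le hM hx hr⟩
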